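/- **Setting.** A $C^2$ spacetime $(M,g)$ is a connected (Hausdorff, second countable) smooth manifold $M$ of dimension $d\ge 1$ without boundary with a time-oriented Lorentzian metric $g$ of class $C^2$ and signature $(-,+,\dots,+)$. Let $T_tM\subset TM$ be the set of timelike vectors, fix a distance function on $TM$ inducing its topology (for instance the distance of a complete Riemannian metric on $TM$), and let $B_r(X)\subset TM$ be its open balls. For $Y\in TM$ let $\gamma_Y:(a_Y,b_Y)\to M$ be the inextendible affinely parametrized geodesic with $\dot\gamma_Y(0)=Y$. For $X\in T_tM$ and $r>0$ put $$O^M_{X,r}=\bigcup_{Y\in B_r(X)\cap T_tM}\gamma_Y((0,b_Y)),$$ and for a topological space $N$ and a map $\iota:M\to N$ put $$O^N_{X,r}=\iota(O^M_{X,r})\cup\Big\{\lim_{t\to b_Y^-}\iota(\gamma_Y(t)) : Y\in B_r(X)\cap T_tM\text{ such that this limit exists in }N\Big\}.$$ A *regular future g-boundary extension* of $(M,g)$ is a topological manifold with (possibly empty) boundary $N$ of dimension $d$ together with a homeomorphism $\iota:M\to\mathrm{int}(N)$ such that 1. for every $p\in\partial N$ there are a smooth future directed timelike curve $\gamma:[0,1)\to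 M$ with $\lim_{t\to1^-}\iota(\gamma(t))=p$ and also a future directed timelike (affinely parametrized) geodesic $\gamma:[0,1)\to M$ with this property; 2. all sets $O^N_{X,r}$ ($X\in T_tM$, $r>0$) are open in $N$, and for every $p\in\partial N$ and every future directed timelike geodesic $\gamma:[0,1)\to M$ with $\lim_{t\to1^-}\iota(\gamma(t))=p$ the sets $O^N_{\dot\gamma(1-1/n),1/m}$, $n,m\in\{1,2,\dots\}$, form a neighbourhood basis of $p$. Two future directed, future inextendible timelike geodesics $\gamma_i:[0,b_i)\to M$ ($i=1,2$, $0<b_i\le\infty$) are *not intertwined* if either (i) for all $r,\rho>0$ there are $s_i\in(0,b_i)$ with $\gamma_1([s_1,b_1))\subset O^M_{\dot\gamma_2(0),\rho}$ and $\gamma_2([s_2,b_2))\subset O^M_{\dot\gamma_1(0),r}$, or (ii) there are $s_i\in(0,b_i)$ and $r,\rho>0$ with $O^M_{\dot\gamma_1(s_1),r}\cap O^M_{\dot\gamma_2(s_2),\rho}=\emptyset$. Otherwise they are *intertwined*. **Theorem.** Let $(M,g)$ be a strongly causal $C^2$ spacetime that has at least one regular future g-boundary extension and contains no two intertwined future directed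 timelike geodesics. Then there is a maximal regular future g-boundary extension $(N_{\max},\iota_{\max})$: for every regular future g-boundary extension $(N,\iota)$ there is a topological embedding $\psi:N\to N_{\max}$ with $\psi\circ\iota=\iota_{\max}$. It is unique: if $(N',\iota')$ is another regular future g-boundary extension with this property, there is a homeomorphism $\psi:N_{\max}\to N'$ with $\psi\circ\iota_{\max}=\iota'$. -/

import Mathlib

open Set Filter Topology
open scoped Manifold ContDiff

universe u v

namespace GBoundary

/-! ### Spacetimes with a `C^2` metric -/

/-- A Lorentzian metric of class `C^2` together with a time orientation on a smooth manifold `M`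
of dimension `d`.  The signature is `(-,+,…,+)`.  The time orientation is given by a continuous
timelike vector field. -/
structure Spacetime (d : ℕ) (M : Type u) [TopologicalSpace M]
    [ChartedSpace (EuclideanSpace ℝ (Fin d)) M] [IsManifold (𝓡 d) ∞ M] where
  /-- the metric tensor -/
  g : ∀ x : M, TangentSpace (𝓡 d) x →L[ℝ] TangentSpace (𝓡 d) x →L[ℝ] ℝ
  symm : ∀ (x : M) (v w : TangentSpace (𝓡 d) x), g x v w = g x w v
  lorentzian : ∀ x : M, ∃ v : TangentSpace (𝓡 d) x, g x v v < 0 ∧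
    ∀ w : TangentSpace (𝓡 d) x, g x v w = 0 → w ≠ 0 → 0 < g x w w
  contMDiff : ContMDiff (𝓡 d)
    ((𝓡 d).prod 𝓘(ℝ, EuclideanSpace ℝ (Fin d) →L[ℝ] EuclideanSpace ℝ (Fin d) →L[ℝ] ℝ)) 2
    (fun x : M ↦ Bundle.TotalSpace.mk'
      (EuclideanSpace ℝ (Fin d) →L[ℝ] EuclideanSpace ℝ (Fin d) →L[ℝ] ℝ)
      (E := fun x : M ↦ (TangentSpace (𝓡 d) x →L[ℝ] TangentSpace (𝓡 d) x →L[ℝ] ℝ)) x (g x))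
  /-- the time-orienting vector field -/
  timeField : ∀ x : M, TangentSpace (𝓡 d) x
  continuous_timeField : Continuous (fun x : M ↦ (⟨x, timeField x⟩ : TangentBundle (𝓡 d) M))
  timelike_timeField : ∀ x : M, g x (timeField x) (timeField x) < 0

/-- A distance function on the tangent bundle `TM` which induces the topology of `TM`, for
example the distance of a complete Riemannian metric on `TM`. -/
structure TangentDistance (d : ℕ) (M : Type u) [TopologicalSpace M]
    [ChartedSpace (EuclideanSpace ℝ (Fin d)) M] [IsManifold (𝓡 d) ∞ M] where
  dist : TangentBundle (𝓡 d) M → TangentBundle (𝓡 d) M → ℝ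
  dist_eq_zero : ∀ X Y, dist X Y = 0 ↔ X = Y
  dist_comm : ∀ X Y, dist X Y = dist Y X
  dist_triangle : ∀ X Y Z, dist X Z ≤ dist X Y + dist Y Z
  nhds_basis : ∀ X : TangentBundle (𝓡 d) M,
    (𝓝 X).HasBasis (fun r : ℝ ↦ 0 < r) (fun r ↦ {Y | dist X Y < r})

section

variable {d : ℕ} {M : Type u} [TopologicalSpace M]
  [ChartedSpace (EuclideanSpace ℝ (Fin d)) M] [IsManifold (𝓡 d) ∞ M]

/-- The open ball `B_r(X)` in `TM`. -/
def TangentDistance.ball (h : TangentDistance d M) (X : TangentBundle (𝓡 d) M) (r : ℝ) :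
    Set (TangentBundle (𝓡 d) M) :=
  {Y | h.dist X Y < r}

/-- The tangent vector `γ'(t)`, as an element of `TM`. -/
noncomputable def velocity (d : ℕ) {M : Type u} [TopologicalSpace M]
    [ChartedSpace (EuclideanSpace ℝ (Fin d)) M] (γ : ℝ → M) (t : ℝ) : TangentBundle (𝓡 d) M :=
  ⟨γ t, mfderiv 𝓘(ℝ, ℝ) (𝓡 d) γ t ((NormedSpace.fromTangentSpace t).symm (1 : ℝ))⟩

/-- The tangent vector at `t ∈ J` of a curve defined on the interval `J` (one-sided at an end point
of `J`), as an element of `TM`. -/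
noncomputable def velocityWithin (d : ℕ) {M : Type u} [TopologicalSpace M]
    [ChartedSpace (EuclideanSpace ℝ (Fin d)) M] (γ : ℝ → M) (J : Set ℝ) (t : ℝ) :
    TangentBundle (𝓡 d) M :=
  ⟨γ t, mfderivWithin 𝓘(ℝ, ℝ) (𝓡 d) γ J t ((NormedSpace.fromTangentSpace t).symm (1 : ℝ))⟩

namespace Spacetime

variable (S : Spacetime d M)

/-- `X` is a timelike tangent vector, i.e. `X ∈ T_tM`. -/
def IsTimelike (X : TangentBundle (𝓡 d) M) : Prop :=
  S.g X.proj X.snd X.snd < 0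

/-- `X` is a future directed timelike tangent vector. -/
def IsFutureTimelike (X : TangentBundle (𝓡 d) M) : Prop :=
  S.g X.proj X.snd X.snd < 0 ∧ S.g X.proj (S.timeField X.proj) X.snd < 0

/-- `X` is a future directed causal tangent vector (the second condition forces `X ≠ 0`). -/
def IsFutureCausal (X : TangentBundle (𝓡 d) M) : Prop :=
  S.g X.proj X.snd X.snd ≤ 0 ∧ S.g X.proj (S.timeField X.proj) X.snd < 0

/-- `γ` is a smooth future directed timelike curve on the interval `J`. -/
def IsTimelikeCurveOn (γ : ℝ → M) (J : Set ℝ) : Prop :=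
  ContMDiffOn 𝓘(ℝ, ℝ) (𝓡 d) ∞ γ J ∧ ∀ t ∈ J, S.IsFutureTimelike (velocityWithin d γ J t)

/-- `γ` is a future directed causal curve of class `C^1` on the interval `J`. -/
def IsCausalCurveOn (γ : ℝ → M) (J : Set ℝ) : Prop :=
  ContMDiffOn 𝓘(ℝ, ℝ) (𝓡 d) 1 γ J ∧ ∀ t ∈ J, S.IsFutureCausal (velocityWithin d γ J t)

/-- Strong causality: every neighbourhood `U` of a point contains a neighbourhood `V` of that point
such that every causal curve segment with end points in `V` stays in `U`. -/
def StronglyCausal : Prop :=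
  ∀ (p : M), ∀ U ∈ 𝓝 p, ∃ V ∈ 𝓝 p, V ⊆ U ∧ ∀ (a b : ℝ) (γ : ℝ → M), a < b →
    S.IsCausalCurveOn γ (Icc a b) → γ a ∈ V → γ b ∈ V → ∀ t ∈ Icc a b, γ t ∈ U

/-! ### Geodesics -/

/-- The metric in the chart `e`, at the point `y` of coordinate space, evaluated at the coordinate
vectors `v` and `w`. -/
noncomputable def chartMetric (e : OpenPartialHomeomorph M (EuclideanSpace ℝ (Fin d)))
    (y v w : EuclideanSpace ℝ (Fin d)) : ℝ :=
  S.g (e.symm y) (mfderiv (𝓡 d) (𝓡 d) e.symm y ((NormedSpace.fromTangentSpace y).symm v))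
    (mfderiv (𝓡 d) (𝓡 d) e.symm y ((NormedSpace.fromTangentSpace y).symm w))

/-- The Christoffel symbols of the first kind of the metric in the chart `e` (contracted with
the coordinate vectors `u`, `v`, `w`):
`Γ(u, v, w) = (∂_u g(v, w) + ∂_v g(u, w) - ∂_w g(u, v)) / 2 = g(∇_u v, w)`. -/
noncomputable def christoffel (e : OpenPartialHomeomorph M (EuclideanSpace ℝ (Fin d)))
    (y u v w : EuclideanSpace ℝ (Fin d)) : ℝ :=
  (fderiv ℝ (fun z ↦ S.chartMetric e z v w) y u + fderiv ℝ (fun z ↦ S.chartMetric e z u w) y v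
    - fderiv ℝ (fun z ↦ S.chartMetric e z u v) y w) / 2

/-- `γ` satisfies the geodesic equation `g(c'', w) + Γ(c', c', w) = 0` for all `w` at time `t`, in
every chart of `M`, where `c` denotes `γ` in the chart. -/
def GeodesicEqAt (γ : ℝ → M) (t : ℝ) : Prop :=
  ContinuousAt γ t ∧
  ∀ e ∈ atlas (EuclideanSpace ℝ (Fin d)) M, γ t ∈ e.source →
    (∀ᶠ s in 𝓝 t, DifferentiableAt ℝ (e ∘ γ) s) ∧
    DifferentiableAt ℝ (deriv (e ∘ γ)) t ∧
    ∀ w : EuclideanSpace ℝ (Fin d),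
      S.chartMetric e (e (γ t)) (deriv (deriv (e ∘ γ)) t) w
        + S.christoffel e (e (γ t)) (deriv (e ∘ γ) t) (deriv (e ∘ γ) t) w = 0

/-- `γ` is an (affinely parametrized) geodesic on the interval `J`.  If `J` is not open this means,
as usual, that `γ` is a geodesic on an open set containing `J`. -/
def IsGeodesicOn (γ : ℝ → M) (J : Set ℝ) : Prop :=
  ∀ t ∈ J, ∀ᶠ s in 𝓝 t, S.GeodesicEqAt γ s

/-- `γ` restricted to `[0, 1)` is a future directed timelike geodesic `[0, 1) → M`. -/
def IsFutureTimelikeGeodesic (γ : ℝ → M) : Prop :=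
  S.IsGeodesicOn γ (Ico 0 1) ∧ ∀ t ∈ Ico (0 : ℝ) 1, S.IsFutureTimelike (velocity d γ t)

end Spacetime

/-- The open interval `(a, b)` of real numbers, with possibly infinite end points. -/
def openInterval (a b : EReal) : Set ℝ := {t : ℝ | a < (t : EReal) ∧ (t : EReal) < b}

/-- The filter describing `t → b⁻`, for real `t` and a possibly infinite `b`. -/
noncomputable def leftOf (b : EReal) : Filter ℝ := comap (fun t : ℝ ↦ (t : EReal)) (𝓝[<] b)

namespace Spacetime

variable (S : Spacetime d M)

/-- `γ` restricted to `(a, b)` is an inextendible geodesic. -/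
def IsInextendibleGeodesic (γ : ℝ → M) (a b : EReal) : Prop :=
  S.IsGeodesicOn γ (openInterval a b) ∧
  ∀ (σ : ℝ → M) (a' b' : EReal), a' ≤ a → b ≤ b' → S.IsGeodesicOn σ (openInterval a' b') →
    EqOn σ γ (openInterval a b) → a' = a ∧ b' = b

/-- `γ` restricted to `(a, b)` is the inextendible geodesic `γ_Y : (a_Y, b_Y) → M` with initial
data `Y` at time `0`. -/
def IsGeodesicWithData (Y : TangentBundle (𝓡 d) M) (γ : ℝ → M) (a b : EReal) : Prop :=
  a < 0 ∧ 0 < b ∧ S.IsInextendibleGeodesic γ a b ∧ velocity d γ 0 = Y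

/-! ### Timelike thickenings -/

variable (h : TangentDistance d M)

/-- The timelike thickening `O^M_{X,r}` in `M`: the union of the sets `γ_Y((0, b_Y))` for
`Y ∈ B_r(X) ∩ T_tM`. -/
def thickening (X : TangentBundle (𝓡 d) M) (r : ℝ) : Set M :=
  {x | ∃ Y ∈ h.ball X r, S.IsTimelike Y ∧ ∃ (γ : ℝ → M) (a b : EReal),
    S.IsGeodesicWithData Y γ a b ∧ ∃ t : ℝ, 0 < t ∧ (t : EReal) < b ∧ γ t = x}

/-- The timelike boundary thickening: the limits `lim_{t → b_Y⁻} ι(γ_Y(t))` for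
`Y ∈ B_r(X) ∩ T_tM`, as far as they exist in `N`. -/
def boundaryThickening {N : Type v} [TopologicalSpace N] (ι : M → N)
    (X : TangentBundle (𝓡 d) M) (r : ℝ) : Set N :=
  {p | ∃ Y ∈ h.ball X r, S.IsTimelike Y ∧ ∃ (γ : ℝ → M) (a b : EReal),
    S.IsGeodesicWithData Y γ a b ∧ Tendsto (ι ∘ γ) (leftOf b) (𝓝 p)}

/-- The timelike thickening `O^N_{X,r}` in `N` with respect to `ι : M → N`: the union of the
interior thickening (the union of the sets `ι(γ_Y((0, b_Y)))`) and the boundary thickening. -/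
def thickeningIn {N : Type v} [TopologicalSpace N] (ι : M → N)
    (X : TangentBundle (𝓡 d) M) (r : ℝ) : Set N :=
  ι '' S.thickening h X r ∪ S.boundaryThickening h ι X r

/-! ### Intertwined timelike geodesics -/

/-- The curves `γ₁ : [0, b₁) → M` and `γ₂ : [0, b₂) → M` are not intertwined: either each
of them eventually stays in every thickening generated by the other one, or they have final
segments with disjoint thickenings. -/
def NotIntertwined (γ₁ : ℝ → M) (b₁ : EReal) (γ₂ : ℝ → M) (b₂ : EReal) : Prop :=
  (∀ r ρ : ℝ, 0 < r → 0 < ρ → ∃ s₁ s₂ : ℝ,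
    0 < s₁ ∧ (s₁ : EReal) < b₁ ∧ 0 < s₂ ∧ (s₂ : EReal) < b₂ ∧
    (∀ t : ℝ, s₁ ≤ t → (t : EReal) < b₁ → γ₁ t ∈ S.thickening h (velocity d γ₂ 0) ρ) ∧
    (∀ t : ℝ, s₂ ≤ t → (t : EReal) < b₂ → γ₂ t ∈ S.thickening h (velocity d γ₁ 0) r)) ∨
  (∃ s₁ s₂ r ρ : ℝ,
    0 < s₁ ∧ (s₁ : EReal) < b₁ ∧ 0 < s₂ ∧ (s₂ : EReal) < b₂ ∧ 0 < r ∧ 0 < ρ ∧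
    S.thickening h (velocity d γ₁ s₁) r ∩ S.thickening h (velocity d γ₂ s₂) ρ = ∅)

/-- The spacetime contains two intertwined future directed, future inextendible timelike
geodesics. -/
def HasIntertwinedGeodesics : Prop :=
  ∃ (Y₁ Y₂ : TangentBundle (𝓡 d) M) (γ₁ γ₂ : ℝ → M) (a₁ b₁ a₂ b₂ : EReal),
    S.IsFutureTimelike Y₁ ∧ S.IsFutureTimelike Y₂ ∧
    S.IsGeodesicWithData Y₁ γ₁ a₁ b₁ ∧ S.IsGeodesicWithData Y₂ γ₂ a₂ b₂ ∧
    ¬ S.NotIntertwined h γ₁ b₁ γ₂ b₂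

end Spacetime

/-! ### Regular future g-boundary extensions -/

/-- A regular future g-boundary extension `(N, ι)` of a spacetime: a topological manifold
with boundary `N` and a homeomorphism `ι` of `M` onto the interior of `N`, such that all points
of the boundary are limits of future directed timelike curves, and even of future directed
timelike geodesics, all timelike thickenings are open, and the thickenings along a geodesic
form a neighbourhood basis of its limit point in the boundary. -/
structure RegularExtension [NeZero d] (S : Spacetime d M) (h : TangentDistance d M) where
  N : Type v
  [topology : TopologicalSpace N]
  [charts : ChartedSpace (EuclideanHalfSpace d) N]
  [t2 : T2Space N]
  [secondCountable : SecondCountableTopology N]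
  ι : M → N
  isEmbedding : IsEmbedding ι
  range_eq : range ι = (𝓡∂ d).interior N
  exists_curve : ∀ p ∈ (𝓡∂ d).boundary N, ∃ γ : ℝ → M,
    S.IsTimelikeCurveOn γ (Ico 0 1) ∧ Tendsto (ι ∘ γ) (𝓝[<] 1) (𝓝 p)
  exists_geodesic : ∀ p ∈ (𝓡∂ d).boundary N, ∃ γ : ℝ → M,
    S.IsFutureTimelikeGeodesic γ ∧ Tendsto (ι ∘ γ) (𝓝[<] 1) (𝓝 p)
  isOpen_thickening : ∀ (X : TangentBundle (𝓡 d) M) (r : ℝ), S.IsTimelike X → 0 < r →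
    IsOpen (S.thickeningIn h ι X r)
  nhds_basis : ∀ p ∈ (𝓡∂ d).boundary N, ∀ γ : ℝ → M,
    S.IsFutureTimelikeGeodesic γ → Tendsto (ι ∘ γ) (𝓝[<] 1) (𝓝 p) →
    (𝓝 p).HasBasis (fun k : ℕ × ℕ ↦ 0 < k.1 ∧ 0 < k.2)
      (fun k ↦ S.thickeningIn h ι (velocity d γ (1 - 1 / (k.1 : ℝ))) (1 / (k.2 : ℝ)))

attribute [instance] RegularExtension.topology RegularExtension.charts RegularExtension.t2
  RegularExtension.secondCountable

namespace RegularExtension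

variable [NeZero d] {S : Spacetime d M} {h : TangentDistance d M}

/-- `(N₁, ι₁) ≲ (N₂, ι₂)`: there is an embedding `N₁ → N₂` compatible with `ι₁` and `ι₂`. -/
def EmbedsIn (A B : RegularExtension.{u, v} S h) : Prop :=
  ∃ ψ : A.N → B.N, IsEmbedding ψ ∧ ∀ x : M, ψ (A.ι x) = B.ι x

/-- `(N₁, ι₁) ≅ (N₂, ι₂)`: there is a homeomorphism `N₁ → N₂` compatible with `ι₁` and `ι₂`. -/
def Equivalent (A B : RegularExtension.{u, v} S h) : Prop :=
  ∃ ψ : A.N ≃ₜ B.N, ∀ x : M, ψ (A.ι x) = B.ι x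

/-- A maximal regular future g-boundary extension: every regular future g-boundary extension embeds
in it. -/
def IsMaximal (A : RegularExtension.{u, v} S h) : Prop :=
  ∀ B : RegularExtension.{u, v} S h, B.EmbedsIn A

end RegularExtension

end

end GBoundary

/-! A point p of an extension is recorded by its trace on M, the filter `comap ι (𝓝 p)`. The traces
from all extensions lie in the single space `Filter M`, and each extension embeds there because N is
a regular space (`isEmbedding_trace`). The maximal extension is the set of all traces with the
topology of `Filter M`; what has to be shown is that this is again a regular extension.

The bridge between M and N is that an inextendible timelike geodesic has no limit in M
(`Spacetime.IsGeodesicWithData.not_tendsto`). Hence O^N meets M exactly in O^M, and the trace of a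
boundary point has a basis of sets O^M attached to any one timelike geodesic ending there
(`trace_hasBasis`): the trace depends on that geodesic alone, not on the extension. If geodesics
ending at p and q are not intertwined, either the traces of p and q are disjoint or one geodesic
converges to both points and the traces agree. This is the Hausdorff property
(`disjoint_trace_of_ne`). With local compactness of N it makes the image of each extension open
(`isOpenEmbedding_toMax`), so charts are inherited and the other axioms can be checked inside single
extensions. Only second countability is global; it comes from a countable dense set of timelike
vectors. Uniqueness follows from the density of M.

Nonconvergence in M is an ODE fact: for a `C^2` metric the geodesic spray is `C^1` and quadratic in
the velocity, so in a small coordinate ball the speed stays bounded and a convergent geodesic could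
be continued. -/

namespace GBoundary

/-! ### Covariance of the geodesic equation under maps of coordinate space. -/

section Covariance

variable {E F : Type*} [NormedAddCommGroup E] [NormedSpace ℝ E]
  [NormedAddCommGroup F] [NormedSpace ℝ F]

theorem fderiv_pullback {G : E → E →L[ℝ] E →L[ℝ] ℝ} {H : F → F →L[ℝ] F →L[ℝ] ℝ} {φ : E → F}
    {y : E} (hG : ∀ᶠ z in 𝓝 y, ∀ v w, G z v w = H (φ z) (fderiv ℝ φ z v) (fderiv ℝ φ z w))
    (hH : DifferentiableAt ℝ H (φ y)) (hφ : ContDiffAt ℝ 2 φ y) (u v w : E) :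
    fderiv ℝ (fun z ↦ G z v w) y u =
      fderiv ℝ (fun z ↦ H z (fderiv ℝ φ y v) (fderiv ℝ φ y w)) (φ y) (fderiv ℝ φ y u)
      + H (φ y) (fderiv ℝ (fderiv ℝ φ) y u v) (fderiv ℝ φ y w)
      + H (φ y) (fderiv ℝ φ y v) (fderiv ℝ (fderiv ℝ φ) y u w) := by
  have h1 : HasFDerivAt φ (fderiv ℝ φ y) y :=
    (hφ.differentiableAt (by norm_num)).hasFDerivAt
  have h2 : HasFDerivAt (fderiv ℝ φ) (fderiv ℝ (fderiv ℝ φ) y) y :=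
    ((hφ.fderiv_right (m := 1) (by norm_num)).differentiableAt (by norm_num)).hasFDerivAt
  have h3 : HasFDerivAt (fun z ↦ H (φ z)) ((fderiv ℝ H (φ y)).comp (fderiv ℝ φ y)) y :=
    HasFDerivAt.comp (g := H) (f := φ) y hH.hasFDerivAt h1
  have h4 := (h3.clm_apply (h2.clm_apply (hasFDerivAt_const v y))).clm_apply
    (h2.clm_apply (hasFDerivAt_const w y))
  have h5 : HasFDerivAt (fun z ↦ G z v w) _ y :=
    h4.congr_of_eventuallyEq (hG.mono fun z hz ↦ hz v w)
  have h6 := (hH.hasFDerivAt.clm_apply (hasFDerivAt_const (fderiv ℝ φ y v) (φ y))).clm_apply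
    (hasFDerivAt_const (fderiv ℝ φ y w) (φ y))
  rw [h5.fderiv, h6.fderiv]
  simp
  ring

/-- Of the six terms containing the second derivative of φ, four cancel by the symmetry of `D²φ` and
of H; the other two are equal and absorb the factor 1/2. The surviving inhomogeneous term is the one
that the second derivative of `φ ∘ c` produces in `deriv_deriv_comp`. -/
theorem christoffel_pullback {G : E → E →L[ℝ] E →L[ℝ] ℝ} {H : F → F →L[ℝ] F →L[ℝ] ℝ} {φ : E → F}
    {y : E} (hG : ∀ᶠ z in 𝓝 y, ∀ v w, G z v w = H (φ z) (fderiv ℝ φ z v) (fderiv ℝ φ z w))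
    (hH : DifferentiableAt ℝ H (φ y)) (hsymm : ∀ v w, H (φ y) v w = H (φ y) w v)
    (hφ : ContDiffAt ℝ 2 φ y) (u v w : E) :
    (fderiv ℝ (fun z ↦ G z v w) y u + fderiv ℝ (fun z ↦ G z u w) y v
      - fderiv ℝ (fun z ↦ G z u v) y w) / 2 =
    (fderiv ℝ (fun z ↦ H z (fderiv ℝ φ y v) (fderiv ℝ φ y w)) (φ y) (fderiv ℝ φ y u)
      + fderiv ℝ (fun z ↦ H z (fderiv ℝ φ y u) (fderiv ℝ φ y w)) (φ y) (fderiv ℝ φ y v)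
      - fderiv ℝ (fun z ↦ H z (fderiv ℝ φ y u) (fderiv ℝ φ y v)) (φ y) (fderiv ℝ φ y w)) / 2
      + H (φ y) (fderiv ℝ (fderiv ℝ φ) y u v) (fderiv ℝ φ y w) := by
  have hs : IsSymmSndFDerivAt ℝ φ y := hφ.isSymmSndFDerivAt (by simp)
  rw [fderiv_pullback hG hH hφ, fderiv_pullback hG hH hφ, fderiv_pullback hG hH hφ,
    hs v u, hs w u, hs w v, hsymm (fderiv ℝ φ y v) (fderiv ℝ (fderiv ℝ φ) y u w)]
  ring

theorem deriv_deriv_comp {φ : E → F} {c : ℝ → E} {t : ℝ} (hφ : ContDiffAt ℝ 2 φ (c t))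
    (hc : ∀ᶠ s in 𝓝 t, DifferentiableAt ℝ c s) (hc' : DifferentiableAt ℝ (deriv c) t) :
    (∀ᶠ s in 𝓝 t, DifferentiableAt ℝ (φ ∘ c) s) ∧ DifferentiableAt ℝ (deriv (φ ∘ c)) t ∧
    deriv (φ ∘ c) t = fderiv ℝ φ (c t) (deriv c t) ∧
    deriv (deriv (φ ∘ c)) t = fderiv ℝ φ (c t) (deriv (deriv c) t)
      + fderiv ℝ (fderiv ℝ φ) (c t) (deriv c t) (deriv c t) := by
  have hcont : ContinuousAt c t := hc.self_of_nhds.continuousAt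
  have h1 : ∀ᶠ s in 𝓝 t, DifferentiableAt ℝ φ (c s) :=
    hcont.eventually ((hφ.eventually (by simp)).mono fun z hz ↦ hz.differentiableAt (by norm_num))
  have h2 : ∀ᶠ s in 𝓝 t, HasDerivAt (φ ∘ c) (fderiv ℝ φ (c s) (deriv c s)) s := by
    filter_upwards [h1, hc] with s hs hs'
    exact hs.hasFDerivAt.comp_hasDerivAt s hs'.hasDerivAt
  have h3 : deriv (φ ∘ c) =ᶠ[𝓝 t] fun s ↦ fderiv ℝ φ (c s) (deriv c s) :=
    h2.mono fun s hs ↦ hs.deriv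
  have h4 : HasFDerivAt (fderiv ℝ φ) (fderiv ℝ (fderiv ℝ φ) (c t)) (c t) :=
    ((hφ.fderiv_right (m := 1) (by norm_num)).differentiableAt (by norm_num)).hasFDerivAt
  have h5 : HasDerivAt (fun s ↦ fderiv ℝ φ (c s)) (fderiv ℝ (fderiv ℝ φ) (c t) (deriv c t)) t :=
    h4.comp_hasDerivAt t hc.self_of_nhds.hasDerivAt
  have h6 := (h5.clm_apply hc'.hasDerivAt).congr_of_eventuallyEq h3
  refine ⟨h2.mono fun s hs ↦ hs.differentiableAt, h6.differentiableAt, h3.self_of_nhds, ?_⟩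
  rw [h6.deriv, add_comm]

end Covariance

/-! ### A priori bounds and continuation for `c'' = F c c'` with F quadratically bounded in the
velocity. -/

section Estimate

variable {E : Type*} [NormedAddCommGroup E] [InnerProductSpace ℝ E]

theorem convex_setOf_le_coe_lt (t₁ : ℝ) (b : EReal) :
    Convex ℝ {t : ℝ | t₁ ≤ t ∧ (t : EReal) < b} := by
  refine Set.OrdConnected.convex ⟨fun x hx y hy z hz ↦ ⟨hx.1.trans hz.1, lt_of_le_of_lt ?_ hy.2⟩⟩
  exact_mod_cast hz.2

/-- A curve in a small ball whose acceleration is bounded by the square of its speed has bounded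
speed, and exists for a bounded time only. -/
theorem speed_bounded_of_accel_le {c y z : ℝ → E} {x : E} {C δ t₁ : ℝ} {b : EReal}
    (hC : 0 ≤ C) (hCδ : C * δ ≤ 1 / 4) (hb : (t₁ : EReal) < b)
    (hc : ∀ t : ℝ, t₁ ≤ t → (t : EReal) < b → HasDerivAt c (y t) t)
    (hy : ∀ t : ℝ, t₁ ≤ t → (t : EReal) < b → HasDerivAt y (z t) t)
    (hy0 : ∀ t : ℝ, t₁ ≤ t → (t : EReal) < b → y t ≠ 0)
    (hz : ∀ t : ℝ, t₁ ≤ t → (t : EReal) < b → ‖z t‖ ≤ C * ‖y t‖ ^ 2)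
    (hδ : ∀ t : ℝ, t₁ ≤ t → (t : EReal) < b → ‖c t - x‖ ≤ δ) :
    b < ⊤ ∧ ∃ K : ℝ, ∀ t : ℝ, t₁ ≤ t → (t : EReal) < b → ‖y t‖ ≤ K := by
  set J : Set ℝ := {t : ℝ | t₁ ≤ t ∧ (t : EReal) < b} with hJ
  have hconv : Convex ℝ J := convex_setOf_le_coe_lt t₁ b
  have ht₁ : t₁ ∈ J := ⟨le_rfl, hb⟩
  -- The component of c - x along the unit tangent: it is bounded by δ, while the bound on the
  -- acceleration gives `k' ≥ ‖y‖ (1 - 2Cδ) ≥ ‖y‖ / 2`. So k controls arc length, and the logarithm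
  -- l of the speed satisfies `|l'| ≤ C ‖y‖ ≤ 2C k'`.
  let k : ℝ → ℝ := fun t ↦ inner ℝ (c t - x) (y t) / ‖y t‖
  let k' : ℝ → ℝ := fun t ↦ ((‖y t‖ ^ 2 + inner ℝ (c t - x) (z t)) * ‖y t‖
    - inner ℝ (c t - x) (y t) * (inner ℝ (y t) (z t) / ‖y t‖)) / ‖y t‖ ^ 2
  let l : ℝ → ℝ := fun t ↦ Real.log ‖y t‖
  let l' : ℝ → ℝ := fun t ↦ (inner ℝ (y t) (z t) / ‖y t‖) / ‖y t‖
  have hpos : ∀ t ∈ J, 0 < ‖y t‖ := fun t ht ↦ norm_pos_iff.mpr (hy0 t ht.1 ht.2)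
  have hn : ∀ t ∈ J, HasDerivAt (fun s ↦ ‖y s‖) (inner ℝ (y t) (z t) / ‖y t‖) t := by
    intro t ht
    have h1 := ((hy t ht.1 ht.2).norm_sq).sqrt (pow_ne_zero 2 (hpos t ht).ne')
    simp only [Real.sqrt_sq (norm_nonneg _)] at h1
    convert h1 using 1
    field_simp
  have hk : ∀ t ∈ J, HasDerivAt k (k' t) t := by
    intro t ht
    have h1 := (((hc t ht.1 ht.2).sub_const x).inner ℝ (hy t ht.1 ht.2)).div (hn t ht)
      (hpos t ht).ne'
    refine h1.congr_deriv ?_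
    simp only [k', real_inner_self_eq_norm_sq]
    ring
  have hl : ∀ t ∈ J, HasDerivAt l (l' t) t := fun t ht ↦ (hn t ht).log (hpos t ht).ne'
  have hkb : ∀ t ∈ J, |k t| ≤ δ := by
    intro t ht
    simp only [k]
    rw [abs_div, abs_norm, div_le_iff₀ (hpos t ht)]
    exact (abs_real_inner_le_norm _ _).trans
      (mul_le_mul_of_nonneg_right (hδ t ht.1 ht.2) (norm_nonneg _))
  have hyz : ∀ t ∈ J, |inner ℝ (y t) (z t)| ≤ C * ‖y t‖ ^ 2 * ‖y t‖ := by
    intro t ht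
    rw [mul_comm _ ‖y t‖]
    exact (abs_real_inner_le_norm _ _).trans
      (mul_le_mul_of_nonneg_left (hz t ht.1 ht.2) (norm_nonneg _))
  have hk' : ∀ t ∈ J, ‖y t‖ / 2 ≤ k' t := by
    intro t ht
    have hp := hpos t ht
    have h1 : |inner ℝ (c t - x) (z t)| ≤ δ * (C * ‖y t‖ ^ 2) :=
      (abs_real_inner_le_norm _ _).trans (mul_le_mul (hδ t ht.1 ht.2) (hz t ht.1 ht.2)
        (norm_nonneg _) ((norm_nonneg _).trans (hδ t ht.1 ht.2)))
    have h2 : |inner ℝ (c t - x) (y t) * (inner ℝ (y t) (z t) / ‖y t‖)|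
        ≤ (δ * ‖y t‖) * (C * ‖y t‖ ^ 2) := by
      rw [abs_mul]
      refine mul_le_mul ((abs_real_inner_le_norm _ _).trans
        (mul_le_mul_of_nonneg_right (hδ t ht.1 ht.2) (norm_nonneg _))) ?_ (abs_nonneg _)
        (mul_nonneg ((norm_nonneg _).trans (hδ t ht.1 ht.2)) (norm_nonneg _))
      rw [abs_div, abs_norm, div_le_iff₀ hp]
      exact hyz t ht
    simp only [k']
    rw [le_div_iff₀ (by positivity)]
    have h3 := mul_le_mul_of_nonneg_right (abs_le.mp h1).1 hp.le
    have h4 := (abs_le.mp h2).2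
    have h5 : C * δ * ‖y t‖ ^ 3 ≤ 1 / 4 * ‖y t‖ ^ 3 :=
      mul_le_mul_of_nonneg_right hCδ (by positivity)
    nlinarith
  have hl' : ∀ t ∈ J, |l' t| ≤ C * ‖y t‖ := by
    intro t ht
    have hp := hpos t ht
    simp only [l']
    rw [abs_div, abs_div, abs_norm, div_le_iff₀ hp, div_le_iff₀ hp]
    refine (hyz t ht).trans (le_of_eq (by ring))
  have key : ∀ (f f' : ℝ → ℝ), (∀ t ∈ J, HasDerivAt f (f' t) t) → (∀ t ∈ J, 0 ≤ f' t) →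
      ∀ t ∈ J, f t₁ ≤ f t := by
    intro f f' hf hf' t ht
    refine monotoneOn_of_deriv_nonneg hconv
      (fun s hs ↦ (hf s hs).continuousAt.continuousWithinAt)
      (fun s hs ↦ (hf s (interior_subset hs)).differentiableAt.differentiableWithinAt)
      (fun s hs ↦ ?_) ht₁ ht ht.1
    rw [(hf s (interior_subset hs)).deriv]
    exact hf' s (interior_subset hs)
  -- `2Ck - l` is nondecreasing and k varies by at most 2δ, whence the constant 4Cδ.
  have hup : ∀ t ∈ J, l t ≤ l t₁ + 4 * C * δ := by
    intro t ht
    have h1 := key (fun s ↦ 2 * C * k s - l s) _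
      (fun s hs ↦ ((hk s hs).const_mul (2 * C)).sub (hl s hs)) (fun s hs ↦ by
        have := mul_le_mul_of_nonneg_left (hk' s hs) hC
        have := (abs_le.mp (hl' s hs)).2
        linarith) t ht
    have h2 := mul_le_mul_of_nonneg_left (abs_le.mp (hkb t ht)).2 hC
    have h3 := mul_le_mul_of_nonneg_left (abs_le.mp (hkb t₁ ht₁)).1 hC
    linarith
  have hlow : ∀ t ∈ J, l t₁ - 4 * C * δ ≤ l t := by
    intro t ht
    have h1 := key (fun s ↦ 2 * C * k s + l s) _
      (fun s hs ↦ ((hk s hs).const_mul (2 * C)).add (hl s hs)) (fun s hs ↦ by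
        have := mul_le_mul_of_nonneg_left (hk' s hs) hC
        have := (abs_le.mp (hl' s hs)).1
        linarith) t ht
    have h2 := mul_le_mul_of_nonneg_left (abs_le.mp (hkb t ht)).2 hC
    have h3 := mul_le_mul_of_nonneg_left (abs_le.mp (hkb t₁ ht₁)).1 hC
    linarith
  refine ⟨?_, Real.exp (l t₁ + 4 * C * δ), fun t ht ht' ↦
    (Real.log_le_iff_le_exp (hpos t ⟨ht, ht'⟩)).mp (hup t ⟨ht, ht'⟩)⟩
  set m := Real.exp (l t₁ - 4 * C * δ) with hm
  have hm0 : 0 < m := Real.exp_pos _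
  have hmy : ∀ t ∈ J, m ≤ ‖y t‖ := fun t ht ↦
    (Real.le_log_iff_exp_le (hpos t ht)).mp (hlow t ht)
  -- The speed is at least m, so k grows at rate at least m/2; since k varies by at most 2δ, the
  -- elapsed time is at most 4δ/m.
  have htb : ∀ t ∈ J, t ≤ t₁ + 4 * δ / m := by
    intro t ht
    have h1 := key (fun s ↦ k s - m / 2 * s) _
      (fun s hs ↦ (hk s hs).sub ((hasDerivAt_id s).const_mul (m / 2))) (fun s hs ↦ by
        have := hk' s hs
        have := hmy s hs
        linarith) t ht
    have h2 := (abs_le.mp (hkb t ht)).2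
    have h3 := (abs_le.mp (hkb t₁ ht₁)).1
    rw [← sub_le_iff_le_add', le_div_iff₀ hm0]
    linarith
  by_contra hcon
  rw [not_lt, top_le_iff] at hcon
  have h0 : 0 ≤ δ := (abs_nonneg _).trans (hkb t₁ ht₁)
  have h1 : 0 ≤ 4 * δ / m := by positivity
  have := htb (t₁ + 4 * δ / m + 1) ⟨by linarith, by rw [hcon]; exact EReal.coe_lt_top _⟩
  linarith

theorem mem_leftOf_iff {a b : EReal} (hab : a < b) {s : Set ℝ} :
    s ∈ leftOf b ↔ ∃ t : ℝ, a < t ∧ (t : EReal) < b ∧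
      ∀ r : ℝ, t ≤ r → (r : EReal) < b → r ∈ s := by
  rw [leftOf, ((nhdsLT_basis_of_exists_lt ⟨a, hab⟩).comap _).mem_iff]
  constructor
  · rintro ⟨c, hc, hcs⟩
    obtain ⟨t, ht, ht'⟩ := EReal.lt_iff_exists_real_btwn.mp (max_lt hc hab)
    exact ⟨t, (le_max_right _ _).trans_lt ht, ht', fun r hr hrb ↦
      hcs ⟨((le_max_left _ _).trans_lt ht).trans_le (EReal.coe_le_coe_iff.mpr hr), hrb⟩⟩
  · rintro ⟨t, _, htb, hts⟩
    exact ⟨t, htb, fun r hr ↦ hts r (EReal.coe_lt_coe_iff.mp hr.1).le hr.2⟩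

theorem leftOf_coe (b : ℝ) : leftOf (b : EReal) = 𝓝[<] b := by
  ext s
  rw [mem_leftOf_iff (EReal.bot_lt_coe b), mem_nhdsLT_iff_exists_Ico_subset]
  simp only [EReal.coe_lt_coe_iff, EReal.bot_lt_coe, true_and]
  exact ⟨fun ⟨t, ht, h⟩ ↦ ⟨t, ht, fun r hr ↦ h r hr.1 hr.2⟩,
    fun ⟨t, ht, h⟩ ↦ ⟨t, ht, fun r hr hr' ↦ h ⟨hr, hr'⟩⟩⟩

/-- A solution of the second order equation `c'' = F c c'` whose right hand side is bounded by the
square of the speed, and whose position converges, can be extended. -/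
theorem exists_extension_of_tendsto [FiniteDimensional ℝ E] {F : E → E → E} {x : E} {C : ℝ}
    (hF : ∀ v, ContDiffAt ℝ 1 (fun p : E × E ↦ F p.1 p.2) (x, v))
    (hFC : ∀ᶠ z in 𝓝 x, ∀ v, ‖F z v‖ ≤ C * ‖v‖ ^ 2)
    {c y : ℝ → E} {t₁ : ℝ} {b : EReal} (hb : (t₁ : EReal) < b)
    (hc : ∀ t : ℝ, t₁ ≤ t → (t : EReal) < b → HasDerivAt c (y t) t)
    (hy : ∀ t : ℝ, t₁ ≤ t → (t : EReal) < b → HasDerivAt y (F (c t) (y t)) t)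
    (hy0 : ∀ t : ℝ, t₁ ≤ t → (t : EReal) < b → y t ≠ 0)
    (hx : Tendsto c (leftOf b) (𝓝 x)) :
    ∃ β : ℝ, b = β ∧ ∃ (ε : ℝ) (c₁ y₁ : ℝ → E), 0 < ε ∧ c₁ β = x ∧ EqOn c₁ c (Ico t₁ β) ∧
      ∀ t ∈ Ioo t₁ (β + ε), HasDerivAt c₁ (y₁ t) t ∧ HasDerivAt y₁ (F (c₁ t) (y₁ t)) t := by
  have hC' : ∀ᶠ z in 𝓝 x, ∀ v, ‖F z v‖ ≤ max C 0 * ‖v‖ ^ 2 := hFC.mono fun z hz v ↦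
    (hz v).trans (mul_le_mul_of_nonneg_right (le_max_left _ _) (sq_nonneg _))
  set D := max C 0 with hD
  have hD0 : 0 ≤ D := le_max_right _ _
  obtain ⟨δ, hδ, hDδ⟩ : ∃ δ > 0, D * δ ≤ 1 / 4 := by
    refine ⟨1 / (4 * (D + 1)), by positivity, ?_⟩
    rw [mul_one_div, div_le_div_iff₀ (by positivity) (by norm_num)]
    linarith
  have hev : ∀ᶠ t in leftOf b, (∀ v, ‖F (c t) v‖ ≤ D * ‖v‖ ^ 2) ∧ ‖c t - x‖ ≤ δ := by
    filter_upwards [hx.eventually hC', hx.eventually (Metric.closedBall_mem_nhds x hδ)] with t h1 h2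
    exact ⟨h1, by rwa [← dist_eq_norm]⟩
  obtain ⟨t₂, ht₂, ht₂b, h2⟩ := (mem_leftOf_iff hb).mp hev
  have ht₁₂ : t₁ ≤ t₂ := by exact_mod_cast ht₂.le
  obtain ⟨hbtop, K, hK⟩ := speed_bounded_of_accel_le hD0 hDδ ht₂b
    (fun t h h' ↦ hc t (ht₁₂.trans h) h') (fun t h h' ↦ hy t (ht₁₂.trans h) h')
    (fun t h h' ↦ hy0 t (ht₁₂.trans h) h') (fun t h h' ↦ (h2 t h h').1 _)
    (fun t h h' ↦ (h2 t h h').2)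
  lift b to ℝ using ⟨hbtop.ne, ((bot_le (a := (t₁ : EReal))).trans_lt hb).ne'⟩
  simp only [EReal.coe_lt_coe_iff] at *
  rw [leftOf_coe] at hx
  -- Bounded speed bounds the acceleration, so y is Lipschitz and has a limit at b, read off from a
  -- Lipschitz extension g.
  have hlip : LipschitzOnWith (Real.toNNReal (D * K ^ 2)) y (Ico t₂ b) := by
    refine (convex_Ico t₂ b).lipschitzOnWith_of_nnnorm_hasDerivWithin_le
      (fun t ht ↦ (hy t (ht₁₂.trans ht.1) ht.2).hasDerivWithinAt) fun t ht ↦ ?_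
    rw [← NNReal.coe_le_coe, coe_nnnorm]
    refine le_trans ?_ (Real.le_coe_toNNReal _)
    refine ((h2 t ht.1 ht.2).1 _).trans (mul_le_mul_of_nonneg_left ?_ hD0)
    exact pow_le_pow_left₀ (norm_nonneg _) (hK t ht.1 ht.2) 2
  obtain ⟨g, hg, hgy⟩ := hlip.extend_finite_dimension
  have hyw : Tendsto y (𝓝[<] b) (𝓝 (g b)) := by
    refine ((hg.continuous.tendsto b).mono_left nhdsWithin_le_nhds).congr' ?_
    filter_upwards [Ico_mem_nhdsLT ht₂b] with t ht using (hgy ht).symm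
  let V : E × E → E × E := fun p ↦ (p.2, F p.1 p.2)
  have hV : ContDiffAt ℝ 1 V (x, g b) := contDiffAt_snd.prodMk (hF (g b))
  obtain ⟨α, hαb, ε, hε, hα⟩ :=
    hV.exists_forall_mem_closedBall_exists_eq_forall_mem_Ioo_hasDerivAt₀ b
  let Z : ℝ → E × E := fun t ↦ if t < b then (c t, y t) else α t
  have hZlt : ∀ t < b, Z t = (c t, y t) := fun t ht ↦ if_pos ht
  have hZge : ∀ t, b ≤ t → Z t = α t := fun t ht ↦ if_neg ht.not_gt
  have hZb : Z b = (x, g b) := (hZge b le_rfl).trans hαb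
  have hZ1 : ∀ t, t₁ ≤ t → t < b → HasDerivAt Z (V (Z t)) t := by
    intro t ht htb
    rw [hZlt t htb]
    refine ((hc t ht htb).prodMk (hy t ht htb)).congr_of_eventuallyEq ?_
    filter_upwards [Iio_mem_nhds htb] with s hs using hZlt s hs
  have hZlim : Tendsto Z (𝓝[<] b) (𝓝 (Z b)) := by
    rw [hZb]
    refine (hx.prodMk_nhds hyw).congr' ?_
    filter_upwards [self_mem_nhdsWithin] with s hs using (hZlt s hs).symm
  -- At the junction the left derivative exists because the derivatives converge from the left; the
  -- right one comes from the local solution α.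
  have hZ2 : HasDerivAt Z (V (Z b)) b := by
    have hleft : HasDerivWithinAt Z (V (Z b)) (Iic b) b := by
      refine hasDerivWithinAt_Iic_of_tendsto_deriv (s := Ioo t₁ b)
        (fun s hs ↦ (hZ1 s hs.1.le hs.2).differentiableAt.differentiableWithinAt)
        (hZlim.mono_left (nhdsWithin_mono _ Ioo_subset_Iio_self)) (Ioo_mem_nhdsLT hb) ?_
      have h3 : Tendsto (fun s ↦ V (Z s)) (𝓝[<] b) (𝓝 (V (Z b))) :=
        (show ContinuousAt V (Z b) from hZb ▸ hV.continuousAt).tendsto.comp hZlim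
      refine h3.congr' ?_
      filter_upwards [Ioo_mem_nhdsLT hb] with s hs using (hZ1 s hs.1.le hs.2).deriv.symm
    have hright : HasDerivWithinAt Z (V (Z b)) (Ici b) b := by
      rw [hZge b le_rfl]
      exact (hα b ⟨by linarith, by linarith⟩).hasDerivWithinAt.congr (fun s hs ↦ hZge s hs)
        (hZge b le_rfl)
    have := hleft.union hright
    rwa [Iic_union_Ici, hasDerivWithinAt_univ] at this
  have hZ : ∀ t ∈ Ioo t₁ (b + ε), HasDerivAt Z (V (Z t)) t := by
    intro t ht
    rcases lt_trichotomy t b with htb | rfl | htb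
    · exact hZ1 t ht.1.le htb
    · exact hZ2
    · rw [hZge t htb.le]
      refine (hα t ⟨by linarith, ht.2⟩).congr_of_eventuallyEq ?_
      filter_upwards [Ioi_mem_nhds htb] with s hs using hZge s (le_of_lt hs)
  refine ⟨b, rfl, ε, fun t ↦ (Z t).1, fun t ↦ (Z t).2, hε, congrArg Prod.fst hZb,
    fun t ht ↦ congrArg Prod.fst (hZlt t ht.2), fun t ht ↦ ⟨?_, ?_⟩⟩
  · exact hasFDerivAt_fst.comp_hasDerivAt t (hZ t ht)
  · exact hasFDerivAt_snd.comp_hasDerivAt t (hZ t ht)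

/-- If the speed of a solution of `c'' = F c c'` vanishes at one time, then it vanishes near this
time, provided that the right hand side is bounded by the square of the speed. -/
theorem eventually_speed_eq_zero {y z : ℝ → E} {t : ℝ} {C : ℝ} (ht : y t = 0)
    (hy : ∀ᶠ s in 𝓝 t, HasDerivAt y (z s) s) (hz : ∀ᶠ s in 𝓝 t, ‖z s‖ ≤ C * ‖y s‖ ^ 2) :
    ∀ᶠ s in 𝓝 t, y s = 0 := by
  have hy1 : ∀ᶠ s in 𝓝 t, ‖y s‖ ≤ 1 := by
    have := hy.self_of_nhds.continuousAt.norm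
    rw [ContinuousAt, ht, norm_zero] at this
    exact this.eventually (ge_mem_nhds one_pos)
  obtain ⟨ε, hε, h⟩ := Metric.eventually_nhds_iff_ball.mp (hy.and (hz.and hy1))
  -- Where the speed is at most 1, the quadratic bound is linear, and Grönwall's inequality applies
  -- forwards and, after time reversal, backwards.
  have hb : ∀ s ∈ Metric.ball t ε, ‖z s‖ ≤ |C| * ‖y s‖ := fun s hs ↦ by
    obtain ⟨-, h1, h2⟩ := h s hs
    refine h1.trans ((mul_le_mul_of_nonneg_right (le_abs_self C) (sq_nonneg _)).trans
      (mul_le_mul_of_nonneg_left ?_ (abs_nonneg C)))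
    nlinarith [norm_nonneg (y s)]
  refine Metric.eventually_nhds_iff_ball.mpr ⟨ε, hε, fun s hs ↦ ?_⟩
  rw [Real.ball_eq_Ioo] at *
  rcases le_total t s with hts | hst
  · have hI : Icc t s ⊆ Ioo (t - ε) (t + ε) := fun r hr ↦ ⟨by linarith [hr.1], hr.2.trans_lt hs.2⟩
    exact eq_zero_of_abs_deriv_le_mul_abs_self_of_eq_zero_right (K := |C|)
      (fun r hr ↦ (h r (hI hr)).1.continuousAt.continuousWithinAt)
      (fun r hr ↦ (h r (hI (Ico_subset_Icc_self hr))).1.hasDerivWithinAt) ht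
      (fun r hr ↦ hb r (hI (Ico_subset_Icc_self hr))) s (right_mem_Icc.mpr hts)
  · have hI : ∀ r ∈ Icc (-t) (-s), -r ∈ Ioo (t - ε) (t + ε) := fun r hr ↦
      ⟨by linarith [hr.2, hs.1], by linarith [hr.1]⟩
    have hd : ∀ r ∈ Icc (-t) (-s), HasDerivAt (fun r ↦ y (-r)) (-z (-r)) r := fun r hr ↦ by
      simpa [Function.comp_def] using (h (-r) (hI r hr)).1.scomp r (hasDerivAt_neg r)
    have := eq_zero_of_abs_deriv_le_mul_abs_self_of_eq_zero_right (K := |C|)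
      (f := fun r ↦ y (-r)) (f' := fun r ↦ -z (-r)) (a := -t) (b := -s)
      (fun r hr ↦ (hd r hr).continuousAt.continuousWithinAt)
      (fun r hr ↦ (hd r (Ico_subset_Icc_self hr)).hasDerivWithinAt) (by simpa using ht)
      (fun r hr ↦ by simpa using hb (-r) (hI r (Ico_subset_Icc_self hr)))
      (-s) (right_mem_Icc.mpr (by linarith))
    simpa using this

end Estimate

/-! ### The metric in coordinates and independence of the geodesic equation from the chart. -/

section ChartMetric

variable {d : ℕ} {M : Type u} [TopologicalSpace M]
  [ChartedSpace (EuclideanSpace ℝ (Fin d)) M]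

/-- The derivative of the inverse of the chart `e`, as an endomorphism of the model space. -/
noncomputable def chartFrame (e : OpenPartialHomeomorph M (EuclideanSpace ℝ (Fin d)))
    (y : EuclideanSpace ℝ (Fin d)) : EuclideanSpace ℝ (Fin d) →L[ℝ] EuclideanSpace ℝ (Fin d) :=
  mfderiv (𝓡 d) (𝓡 d) e.symm y

variable [IsManifold (𝓡 d) ∞ M]
  (S : Spacetime d M) {e e' : OpenPartialHomeomorph M (EuclideanSpace ℝ (Fin d))}

/-- The metric in the chart `e`, as a field of bilinear forms. -/
noncomputable def Spacetime.chartForm (e : OpenPartialHomeomorph M (EuclideanSpace ℝ (Fin d)))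
    (y : EuclideanSpace ℝ (Fin d)) :
    EuclideanSpace ℝ (Fin d) →L[ℝ] EuclideanSpace ℝ (Fin d) →L[ℝ] ℝ :=
  ContinuousLinearMap.bilinearComp (show EuclideanSpace ℝ (Fin d) →L[ℝ]
    EuclideanSpace ℝ (Fin d) →L[ℝ] ℝ from S.g (e.symm y)) (chartFrame e y) (chartFrame e y)

theorem Spacetime.chartForm_apply (y v w : EuclideanSpace ℝ (Fin d)) :
    S.chartForm e y v w = S.chartMetric e y v w := rfl

theorem Spacetime.chartForm_symm (y v w : EuclideanSpace ℝ (Fin d)) :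
    S.chartForm e y v w = S.chartForm e y w v := S.symm _ _ _

theorem contMDiffOn_chart_symm (he : e ∈ atlas (EuclideanSpace ℝ (Fin d)) M) :
    ContMDiffOn (𝓡 d) (𝓡 d) ∞ e.symm e.target :=
  contMDiffOn_symm_of_mem_maximalAtlas (IsManifold.subset_maximalAtlas he)

theorem contMDiffOn_chart_frame (he : e ∈ atlas (EuclideanSpace ℝ (Fin d)) M)
    (v : EuclideanSpace ℝ (Fin d)) :
    ContMDiffOn (𝓡 d) (𝓡 d).tangent 2
      (fun y ↦ (⟨e.symm y, chartFrame e y v⟩ : TangentBundle (𝓡 d) M)) e.target := by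
  have : IsManifold (𝓡 d) 1 M := IsManifold.of_le (n := ∞) (by simp)
  have h1 := (contMDiffOn_chart_symm he).contMDiffOn_tangentMapWithin (m := 2) (by norm_cast)
    e.open_target.uniqueMDiffOn
  have h2 : ContMDiff (𝓡 d) (𝓡 d).tangent 2
      (fun y ↦ (⟨y, v⟩ : TangentBundle (𝓡 d) (EuclideanSpace ℝ (Fin d)))) :=
    contMDiff_vectorSpace_iff_contDiff.mpr contDiff_const
  refine (h1.comp h2.contMDiffOn fun y hy ↦ hy).congr fun y hy ↦ ?_
  simp only [Function.comp_apply, tangentMapWithin, chartFrame]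
  rw [mfderivWithin_of_isOpen e.open_target hy]
  rfl

theorem Spacetime.contDiffOn_chartForm (he : e ∈ atlas (EuclideanSpace ℝ (Fin d)) M) :
    ContDiffOn ℝ 2 (S.chartForm e) e.target := by
  rw [contDiffOn_clm_apply]
  intro v
  rw [contDiffOn_clm_apply]
  intro w y hy
  have h1 : ContMDiffWithinAt (𝓡 d) ((𝓡 d).prod 𝓘(ℝ)) 2 (fun z ↦ Bundle.TotalSpace.mk' ℝ
      (E := Bundle.Trivial M ℝ) (e.symm z)
      (S.g (e.symm z) (chartFrame e z v) (chartFrame e z w))) e.target y := by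
    apply ContMDiffWithinAt.clm_bundle_apply₂ (F₁ := EuclideanSpace ℝ (Fin d))
      (F₂ := EuclideanSpace ℝ (Fin d))
    · exact ContMDiffAt.comp_contMDiffWithinAt y S.contMDiff.contMDiffAt
        ((contMDiffOn_chart_symm he y hy).of_le (by norm_cast))
    · exact contMDiffOn_chart_frame he v y hy
    · exact contMDiffOn_chart_frame he w y hy
  rw [Bundle.contMDiffWithinAt_totalSpace] at h1
  exact h1.2.contDiffWithinAt

theorem Spacetime.contDiffAt_chartForm (he : e ∈ atlas (EuclideanSpace ℝ (Fin d)) M)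
    {y : EuclideanSpace ℝ (Fin d)} (hy : y ∈ e.target) : ContDiffAt ℝ 2 (S.chartForm e) y :=
  (S.contDiffOn_chartForm he).contDiffAt (e.open_target.mem_nhds hy)

/-! ### Change of charts -/

theorem contDiffAt_transition (he : e ∈ atlas (EuclideanSpace ℝ (Fin d)) M)
    (he' : e' ∈ atlas (EuclideanSpace ℝ (Fin d)) M) {y : EuclideanSpace ℝ (Fin d)}
    (hy : y ∈ e.target) (hy' : e.symm y ∈ e'.source) : ContDiffAt ℝ ∞ (e' ∘ e.symm) y := by
  have h1 : ContMDiffAt (𝓡 d) (𝓡 d) ∞ (e' ∘ e.symm) y :=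
    ContMDiffAt.comp y (contMDiffAt_of_mem_maximalAtlas (IsManifold.subset_maximalAtlas he') hy')
      ((contMDiffOn_chart_symm he).contMDiffAt (e.open_target.mem_nhds hy))
  exact h1.contDiffAt

theorem Spacetime.chartForm_transition (he : e ∈ atlas (EuclideanSpace ℝ (Fin d)) M)
    (he' : e' ∈ atlas (EuclideanSpace ℝ (Fin d)) M) {y : EuclideanSpace ℝ (Fin d)}
    (hy : y ∈ e.target) (hy' : e.symm y ∈ e'.source) (v w : EuclideanSpace ℝ (Fin d)) :
    S.chartForm e y v w = S.chartForm e' ((e' ∘ e.symm) y) (fderiv ℝ (e' ∘ e.symm) y v)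
      (fderiv ℝ (e' ∘ e.symm) y w) := by
  have h1 : (e'.symm ∘ (e' ∘ e.symm)) =ᶠ[𝓝 y] e.symm := by
    filter_upwards [(e.continuousAt_symm hy).preimage_mem_nhds (e'.open_source.mem_nhds hy')]
      with z hz using e'.left_inv hz
  have h2 : MDifferentiableAt (𝓡 d) (𝓡 d) (e' ∘ e.symm) y :=
    ((contDiffAt_transition he he' hy hy').differentiableAt (by simp)).mdifferentiableAt
  have h3 : MDifferentiableAt (𝓡 d) (𝓡 d) e'.symm ((e' ∘ e.symm) y) :=
    ((contMDiffOn_chart_symm he').contMDiffAt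
      (e'.open_target.mem_nhds (e'.map_source hy'))).mdifferentiableAt (by simp)
  have h4 : ∀ u, chartFrame e y u = chartFrame e' ((e' ∘ e.symm) y)
      (fderiv ℝ (e' ∘ e.symm) y u) := by
    intro u
    have h5 := mfderiv_comp y h3 h2
    rw [h1.mfderiv_eq, mfderiv_eq_fderiv] at h5
    exact congrArg (fun A ↦ A u) h5
  have h6 : e'.symm ((e' ∘ e.symm) y) = e.symm y := e'.left_inv hy'
  -- The base points are equal only propositionally; reading tangent vectors in the common model
  -- space makes substitution possible.
  have h7 : ∀ (p q : M) (_ : p = q) (a a' b b' : EuclideanSpace ℝ (Fin d)), a = a' → b = b' →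
      (show ℝ from S.g p a b) = S.g q a' b' := by
    rintro p _ rfl a _ b _ rfl rfl
    rfl
  exact h7 _ _ h6.symm _ _ _ _ (h4 v) (h4 w)

/-- The reverse transition map gives a right inverse. Consequently every test vector in the chart
`e'` comes from a test vector in `e`. -/
theorem fderiv_transition_surjective (he : e ∈ atlas (EuclideanSpace ℝ (Fin d)) M)
    (he' : e' ∈ atlas (EuclideanSpace ℝ (Fin d)) M) {y : EuclideanSpace ℝ (Fin d)}
    (hy : y ∈ e.target) (hy' : e.symm y ∈ e'.source) :
    Function.Surjective (fderiv ℝ (e' ∘ e.symm) y) := by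
  have h0 : (e' ∘ e.symm) y ∈ e'.target := e'.map_source hy'
  have h00 : e'.symm ((e' ∘ e.symm) y) = e.symm y := e'.left_inv hy'
  have h01 : e'.symm ((e' ∘ e.symm) y) ∈ e.source := by rw [h00]; exact e.map_target hy
  have h02 : (e ∘ e'.symm) ((e' ∘ e.symm) y) = y := by
    rw [Function.comp_apply, h00, e.right_inv hy]
  have h1 : ((e' ∘ e.symm) ∘ (e ∘ e'.symm)) =ᶠ[𝓝 ((e' ∘ e.symm) y)] id := by
    filter_upwards [e'.open_target.mem_nhds h0, (e'.continuousAt_symm h0).preimage_mem_nhds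
      (e.open_source.mem_nhds h01)] with z hz hz'
    simp only [Function.comp_apply, id]
    rw [e.left_inv hz', e'.right_inv hz]
  have h2 : HasFDerivAt (e' ∘ e.symm) (fderiv ℝ (e' ∘ e.symm) y)
      ((e ∘ e'.symm) ((e' ∘ e.symm) y)) := by
    rw [h02]
    exact ((contDiffAt_transition he he' hy hy').differentiableAt (by simp)).hasFDerivAt
  have h3 := h2.comp _
    ((contDiffAt_transition he' he h0 h01).differentiableAt (by simp)).hasFDerivAt
  have h4 := (h3.congr_of_eventuallyEq h1.symm).unique (hasFDerivAt_id _)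
  exact fun w ↦ ⟨_, congrArg (fun A ↦ A w) h4⟩

/-- The geodesic equation in the chart `e`. -/
def Spacetime.ChartGeodesicEqAt (e : OpenPartialHomeomorph M (EuclideanSpace ℝ (Fin d)))
    (γ : ℝ → M) (t : ℝ) : Prop :=
  (∀ᶠ s in 𝓝 t, DifferentiableAt ℝ (e ∘ γ) s) ∧ DifferentiableAt ℝ (deriv (e ∘ γ)) t ∧
    ∀ w : EuclideanSpace ℝ (Fin d),
      S.chartMetric e (e (γ t)) (deriv (deriv (e ∘ γ)) t) w
        + S.christoffel e (e (γ t)) (deriv (e ∘ γ) t) (deriv (e ∘ γ) t) w = 0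

/-- The inhomogeneous terms in the transformation laws of the acceleration and of the Christoffel
symbols match. Since `GeodesicEqAt` demands the equation in every chart, this is what allows a
geodesic to be constructed in a single one. -/
theorem Spacetime.ChartGeodesicEqAt.transition {γ : ℝ → M} {t : ℝ}
    (h : S.ChartGeodesicEqAt e γ t) (hγ : ContinuousAt γ t)
    (he : e ∈ atlas (EuclideanSpace ℝ (Fin d)) M) (ht : γ t ∈ e.source)
    (he' : e' ∈ atlas (EuclideanSpace ℝ (Fin d)) M) (ht' : γ t ∈ e'.source) :
    S.ChartGeodesicEqAt e' γ t := by
  have hy : (e ∘ γ) t ∈ e.target := e.map_source ht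
  have hsymm : e.symm ((e ∘ γ) t) = γ t := e.left_inv ht
  have hy' : e.symm ((e ∘ γ) t) ∈ e'.source := by rwa [hsymm]
  have hφ : ContDiffAt ℝ 2 (e' ∘ e.symm) ((e ∘ γ) t) :=
    (contDiffAt_transition he he' hy hy').of_le (by norm_cast)
  have hφt : (e' ∘ e.symm) ((e ∘ γ) t) = e' (γ t) := congrArg e' hsymm
  have heq : ((e' ∘ e.symm) ∘ (e ∘ γ)) =ᶠ[𝓝 t] e' ∘ γ := by
    filter_upwards [hγ.preimage_mem_nhds (e.open_source.mem_nhds ht)] with s hs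
    exact congrArg e' (e.left_inv hs)
  obtain ⟨h1, h2, h3⟩ := h
  obtain ⟨k1, k2, k3, k4⟩ := deriv_deriv_comp hφ h1 h2
  rw [heq.deriv.differentiableAt_iff] at k2
  rw [heq.deriv_eq] at k3
  rw [heq.deriv.deriv_eq] at k4
  refine ⟨?_, k2, fun w' ↦ ?_⟩
  · filter_upwards [k1, heq.eventuallyEq_nhds] with s hs hs'
    exact hs'.differentiableAt_iff.mp hs
  obtain ⟨w, rfl⟩ := fderiv_transition_surjective he he' hy hy' w'
  have hG : ∀ᶠ z in 𝓝 ((e ∘ γ) t), ∀ v w, S.chartForm e z v w =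
      S.chartForm e' ((e' ∘ e.symm) z) (fderiv ℝ (e' ∘ e.symm) z v)
        (fderiv ℝ (e' ∘ e.symm) z w) := by
    filter_upwards [e.open_target.mem_nhds hy, (e.continuousAt_symm hy).preimage_mem_nhds
      (e'.open_source.mem_nhds hy')] with z hz hz' v w
    exact S.chartForm_transition he he' hz hz' v w
  have hH : DifferentiableAt ℝ (S.chartForm e') ((e' ∘ e.symm) ((e ∘ γ) t)) :=
    (S.contDiffAt_chartForm he' (e'.map_source hy')).differentiableAt (by norm_num)
  have key := christoffel_pullback hG hH (S.chartForm_symm _) hφ (deriv (e ∘ γ) t)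
    (deriv (e ∘ γ) t) w
  have h3w := h3 w
  have hGt := hG.self_of_nhds (deriv (deriv (e ∘ γ)) t) w
  rw [hφt] at key hGt
  rw [k3, k4]
  simp only [christoffel, ← chartForm_apply] at h3w ⊢
  simp only [Function.comp_apply] at key hGt h3w ⊢
  rw [map_add, add_apply, ← hGt]
  linarith

end ChartMetric

set_option maxSynthPendingDepth 3

/-! ### The geodesic spray of a nondegenerate form: regularity and quadratic growth. -/

section Spray

variable {E : Type*} [NormedAddCommGroup E] [NormedSpace ℝ E]

/-- The linear form `w ↦ -Γ(v, v, w)` at the point `y`, where `Γ` are the Christoffel symbols of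
the first kind of `G`. -/
noncomputable def christoffelForm (G : E → E →L[ℝ] E →L[ℝ] ℝ) (y v : E) : E →L[ℝ] ℝ :=
  (2⁻¹ : ℝ) • ((fderiv ℝ G y).flip v).flip v - fderiv ℝ G y v v

/-- The geodesic spray of `G`: the geodesic equation is `c'' = spray G c c'`. -/
noncomputable def spray (G : E → E →L[ℝ] E →L[ℝ] ℝ) (y v : E) : E :=
  (G y).inverse (christoffelForm G y v)

theorem christoffelForm_apply {G : E → E →L[ℝ] E →L[ℝ] ℝ} {y : E} (hG : DifferentiableAt ℝ G y)
    (v w : E) : christoffelForm G y v w =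
      -((fderiv ℝ (fun z ↦ G z v w) y v + fderiv ℝ (fun z ↦ G z v w) y v
        - fderiv ℝ (fun z ↦ G z v v) y w) / 2) := by
  have h (a b : E) := ((hG.hasFDerivAt.clm_apply (hasFDerivAt_const a y)).clm_apply
    (hasFDerivAt_const b y)).fderiv
  rw [h v w, h v v]
  simp [christoffelForm]
  ring

theorem exists_equiv_of_injective [FiniteDimensional ℝ E] {B : E →L[ℝ] E →L[ℝ] ℝ}
    (hB : Function.Injective B) : ∃ A : E ≃L[ℝ] (E →L[ℝ] ℝ), (A : E →L[ℝ] (E →L[ℝ] ℝ)) = B := by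
  have hfin : Module.finrank ℝ E = Module.finrank ℝ (E →L[ℝ] ℝ) := by
    rw [← Subspace.dual_finrank_eq (K := ℝ) (V := E)]
    exact (LinearMap.toContinuousLinearMap (𝕜 := ℝ) (E := E) (F' := ℝ)).finrank_eq
  refine ⟨(LinearEquiv.ofInjectiveOfFinrankEq (B : E →ₗ[ℝ] (E →L[ℝ] ℝ)) hB
    hfin).toContinuousLinearEquiv, ?_⟩
  ext v w
  rfl

theorem spray_spec [FiniteDimensional ℝ E] {G : E → E →L[ℝ] E →L[ℝ] ℝ} {y : E}
    (hG : Function.Injective (G y)) (u v : E) :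
    u = spray G y v ↔ G y u = christoffelForm G y v := by
  obtain ⟨A, hA⟩ := exists_equiv_of_injective hG
  rw [spray, ← hA, ContinuousLinearMap.inverse_equiv]
  exact (A.eq_symm_apply).trans Iff.rfl

/-- Inversion is smooth and only one derivative of G enters, so a `C^2` metric leaves exactly the
`C^1` regularity used for local solvability. -/
theorem contDiffAt_spray [FiniteDimensional ℝ E] {G : E → E →L[ℝ] E →L[ℝ] ℝ} {x : E}
    (hG : ContDiffAt ℝ 2 G x) (hinj : Function.Injective (G x)) (v : E) :
    ContDiffAt ℝ 1 (fun p : E × E ↦ spray G p.1 p.2) (x, v) := by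
  obtain ⟨A, hA⟩ := exists_equiv_of_injective hinj
  have h0 : ContDiffAt ℝ 1 (fun z ↦ (G z).inverse) x := by
    have := contDiffAt_map_inverse (n := 1) A
    rw [hA] at this
    exact this.comp x (hG.of_le (by norm_num))
  have h1 : ContDiffAt ℝ 1 (fderiv ℝ G) x := hG.fderiv_right (by norm_num)
  have h2 : ContDiffAt ℝ 1 (fun p : E × E ↦ fderiv ℝ G p.1) (x, v) := h1.comp (x, v) contDiffAt_fst
  have hv : ContDiffAt ℝ 1 (fun p : E × E ↦ p.2) (x, v) := contDiffAt_snd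
  have h3 : ContDiffAt ℝ 1 (fun p : E × E ↦ ((fderiv ℝ G p.1).flip p.2).flip p.2) (x, v) := by
    have hf1 : ContDiffAt ℝ 1 (fun p : E × E ↦ (fderiv ℝ G p.1).flip) (x, v) :=
      (ContinuousLinearMap.flipₗᵢ ℝ E E (E →L[ℝ] ℝ)).contDiff.contDiffAt.comp (x, v) h2
    have hf2 : ContDiffAt ℝ 1 (fun p : E × E ↦ (fderiv ℝ G p.1).flip p.2) (x, v) :=
      hf1.clm_apply hv
    exact ((ContinuousLinearMap.flipₗᵢ ℝ E E ℝ).contDiff.contDiffAt.comp (x, v) hf2).clm_apply hv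
  have h4 : ContDiffAt ℝ 1 (fun p : E × E ↦ (G p.1).inverse) (x, v) := h0.comp (x, v) contDiffAt_fst
  have h5 : ContDiffAt ℝ 1 (fun p : E × E ↦ christoffelForm G p.1 p.2) (x, v) :=
    (h3.const_smul (2⁻¹ : ℝ)).sub ((h2.clm_apply hv).clm_apply hv)
  exact h4.clm_apply h5

theorem norm_christoffelForm_le (G : E → E →L[ℝ] E →L[ℝ] ℝ) (y v : E) :
    ‖christoffelForm G y v‖ ≤ 2 * ‖fderiv ℝ G y‖ * ‖v‖ ^ 2 := by
  refine ContinuousLinearMap.opNorm_le_bound _ (by positivity) fun w ↦ ?_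
  have h (a b c : E) : ‖fderiv ℝ G y a b c‖ ≤ ‖fderiv ℝ G y‖ * ‖a‖ * ‖b‖ * ‖c‖ :=
    (ContinuousLinearMap.le_opNorm₂ _ b c).trans (by
      gcongr
      exact ContinuousLinearMap.le_opNorm _ a)
  have h1 := h w v v
  have h2 := h v v w
  have h3 : christoffelForm G y v w = 2⁻¹ * fderiv ℝ G y w v v - fderiv ℝ G y v v w := by
    simp [christoffelForm]
  rw [h3]
  have h4 : ‖2⁻¹ * fderiv ℝ G y w v v - fderiv ℝ G y v v w‖ ≤
      2⁻¹ * ‖fderiv ℝ G y w v v‖ + ‖fderiv ℝ G y v v w‖ :=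
    (norm_sub_le _ _).trans (by simp)
  have h5 : 0 ≤ ‖fderiv ℝ G y‖ * ‖v‖ ^ 2 * ‖w‖ := by positivity
  nlinarith

/-- The inverse of G and its first derivative are locally bounded, and the Christoffel form is
quadratic in v. The constant is uniform in z near x, as the speed estimate requires. -/
theorem norm_spray_le [FiniteDimensional ℝ E] {G : E → E →L[ℝ] E →L[ℝ] ℝ} {x : E}
    (hG : ContDiffAt ℝ 2 G x) (hinj : Function.Injective (G x)) :
    ∃ C : ℝ, ∀ᶠ z in 𝓝 x, ∀ v, ‖spray G z v‖ ≤ C * ‖v‖ ^ 2 := by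
  obtain ⟨A, hA⟩ := exists_equiv_of_injective hinj
  have h0 : ContinuousAt (fun z ↦ (G z).inverse) x := by
    have := (contDiffAt_map_inverse (n := 1) A).continuousAt
    rw [hA] at this
    exact this.comp hG.continuousAt
  have h1 : ContinuousAt (fderiv ℝ G) x :=
    (hG.fderiv_right (m := 1) (by norm_num)).continuousAt
  refine ⟨(‖(G x).inverse‖ + 1) * (2 * (‖fderiv ℝ G x‖ + 1)), ?_⟩
  filter_upwards [h0.norm.eventually (ge_mem_nhds (lt_add_one _)),
    h1.norm.eventually (ge_mem_nhds (lt_add_one _))] with z hz hz' v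
  refine (ContinuousLinearMap.le_opNorm _ _).trans ?_
  rw [mul_assoc]
  gcongr
  exact (norm_christoffelForm_le G z v).trans (by gcongr)

end Spray

/-! ### Geodesics as solutions of the spray equation. -/

section Geodesic

variable {d : ℕ} {M : Type u} [TopologicalSpace M]
  [ChartedSpace (EuclideanSpace ℝ (Fin d)) M] [IsManifold (𝓡 d) ∞ M]
  (S : Spacetime d M) {e : OpenPartialHomeomorph M (EuclideanSpace ℝ (Fin d))}

theorem chartFrame_surjective (he : e ∈ atlas (EuclideanSpace ℝ (Fin d)) M)
    {y : EuclideanSpace ℝ (Fin d)} (hy : y ∈ e.target) :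
    Function.Surjective (chartFrame e y) := by
  have hM : IsManifold (𝓡 d) 1 M := IsManifold.of_le (n := ∞) (by simp)
  have h := (mdifferentiable_of_mem_atlas (I := 𝓡 d) he).symm_comp_deriv (e.map_target hy)
  rw [e.right_inv hy] at h
  exact fun w ↦ ⟨_, congrArg (fun A ↦ A w) h⟩

/-- A nonzero kernel vector would be orthogonal to a timelike vector, hence spacelike; but it is
also orthogonal to itself. -/
theorem Spacetime.chartForm_injective (he : e ∈ atlas (EuclideanSpace ℝ (Fin d)) M)
    {y : EuclideanSpace ℝ (Fin d)} (hy : y ∈ e.target) :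
    Function.Injective (S.chartForm e y) := by
  have hsurj := chartFrame_surjective he hy
  have hinj : Function.Injective (chartFrame e y) :=
    LinearMap.injective_iff_surjective (f := (chartFrame e y).toLinearMap).mpr hsurj
  rw [injective_iff_map_eq_zero]
  intro v hv
  obtain ⟨u, -, hu⟩ := S.lorentzian (e.symm y)
  obtain ⟨u', hu'⟩ := hsurj u
  have h0 (w) : S.g (e.symm y) (chartFrame e y v) (chartFrame e y w) = 0 :=
    congrArg (fun A ↦ A w) hv
  by_contra hne
  have h1 : S.g (e.symm y) u (chartFrame e y v) = 0 :=
    (S.symm _ _ _).trans ((congrArg (S.g (e.symm y) (chartFrame e y v)) hu'.symm).trans (h0 u'))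
  have h2 := hu _ h1 fun h ↦ hne (hinj (h.trans (map_zero _).symm))
  exact h2.ne' (h0 v)

/-- Nondegeneracy turns the equation tested against all w into an explicit second order ODE. -/
theorem Spacetime.chartGeodesicEqAt_iff (he : e ∈ atlas (EuclideanSpace ℝ (Fin d)) M)
    {γ : ℝ → M} {t : ℝ} (ht : γ t ∈ e.source) : S.ChartGeodesicEqAt e γ t ↔
    (∀ᶠ s in 𝓝 t, HasDerivAt (e ∘ γ) (deriv (e ∘ γ) s) s) ∧
      HasDerivAt (deriv (e ∘ γ)) (spray (S.chartForm e) (e (γ t)) (deriv (e ∘ γ) t)) t := by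
  have hy := e.map_source ht
  have key : ∀ u v : EuclideanSpace ℝ (Fin d), u = spray (S.chartForm e) (e (γ t)) v ↔
      ∀ w, S.chartMetric e (e (γ t)) u w + S.christoffel e (e (γ t)) v v w = 0 := by
    intro u v
    rw [spray_spec (S.chartForm_injective he hy), ContinuousLinearMap.ext_iff]
    refine forall_congr' fun w ↦ ?_
    rw [christoffelForm_apply ((S.contDiffAt_chartForm he hy).differentiableAt (by norm_num)),
      ← add_eq_zero_iff_eq_neg]
    rfl
  refine and_congr (eventually_congr (Eventually.of_forall fun s ↦
    hasDerivAt_deriv_iff.symm)) ?_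
  constructor
  · rintro ⟨h1, h2⟩
    rw [← (key _ _).mpr h2]
    exact h1.hasDerivAt
  · intro h
    exact ⟨h.differentiableAt, (key _ _).mp h.deriv⟩

theorem Spacetime.GeodesicEqAt.chart {γ : ℝ → M} {t : ℝ} (h : S.GeodesicEqAt γ t)
    (he : e ∈ atlas (EuclideanSpace ℝ (Fin d)) M) (ht : γ t ∈ e.source) :
    S.ChartGeodesicEqAt e γ t := h.2 e he ht

theorem Spacetime.GeodesicEqAt.of_chart {γ : ℝ → M} {t : ℝ} (h : S.ChartGeodesicEqAt e γ t)
    (hγ : ContinuousAt γ t) (he : e ∈ atlas (EuclideanSpace ℝ (Fin d)) M) (ht : γ t ∈ e.source) :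
    S.GeodesicEqAt γ t := ⟨hγ, fun _ he' ht' ↦ h.transition S hγ he ht he' ht'⟩

theorem Spacetime.GeodesicEqAt.congr {γ σ : ℝ → M} {t : ℝ} (h : S.GeodesicEqAt γ t)
    (hσ : σ =ᶠ[𝓝 t] γ) : S.GeodesicEqAt σ t := by
  refine ⟨h.1.congr hσ.symm, fun e he ht ↦ ?_⟩
  have heq : e ∘ σ =ᶠ[𝓝 t] e ∘ γ := hσ.fun_comp e
  rw [hσ.self_of_nhds] at ht
  obtain ⟨h1, h2, h3⟩ := h.2 e he ht
  refine ⟨?_, heq.deriv.differentiableAt_iff.mpr h2, ?_⟩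
  · filter_upwards [h1, heq.eventuallyEq_nhds] with s hs hs'
    exact hs'.differentiableAt_iff.mpr hs
  · rwa [heq.deriv_eq, heq.deriv.deriv_eq, hσ.self_of_nhds]

theorem Spacetime.IsGeodesicOn.congr {γ σ : ℝ → M} {J : Set ℝ} (h : S.IsGeodesicOn γ J)
    (hσ : ∀ t ∈ J, σ =ᶠ[𝓝 t] γ) : S.IsGeodesicOn σ J := fun t ht ↦ by
  filter_upwards [h t ht, (hσ t ht).eventuallyEq_nhds] with s hs hs'
  exact hs.congr S hs'

theorem Spacetime.IsGeodesicOn.of_forall {γ : ℝ → M} {J : Set ℝ} (hJ : IsOpen J)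
    (h : ∀ t ∈ J, S.GeodesicEqAt γ t) : S.IsGeodesicOn γ J := fun t ht ↦ by
  filter_upwards [hJ.mem_nhds ht] with s hs using h s hs

end Geodesic

/-! ### Inextendible nonconstant geodesics have no limit in the spacetime. -/

section Extension

variable {d : ℕ} {M : Type u} [TopologicalSpace M]
  [ChartedSpace (EuclideanSpace ℝ (Fin d)) M]
  {e e' : OpenPartialHomeomorph M (EuclideanSpace ℝ (Fin d))}

/-- The curve `γ` has vanishing velocity at time `t`, in some chart. -/
def IsStationaryAt (d : ℕ) {M : Type u} [TopologicalSpace M]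
    [ChartedSpace (EuclideanSpace ℝ (Fin d)) M] (γ : ℝ → M) (t : ℝ) : Prop :=
  ∃ e ∈ atlas (EuclideanSpace ℝ (Fin d)) M, γ t ∈ e.source ∧ deriv (e ∘ γ) t = 0

variable [IsManifold (𝓡 d) ∞ M] (S : Spacetime d M)

theorem Spacetime.GeodesicEqAt.deriv_eq_zero {γ : ℝ → M} {t : ℝ} (h : S.GeodesicEqAt γ t)
    (hs : IsStationaryAt d γ t) (he' : e' ∈ atlas (EuclideanSpace ℝ (Fin d)) M)
    (ht' : γ t ∈ e'.source) : deriv (e' ∘ γ) t = 0 := by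
  obtain ⟨e, he, ht, h0⟩ := hs
  have hy : (e ∘ γ) t ∈ e.target := e.map_source ht
  have hy' : e.symm ((e ∘ γ) t) ∈ e'.source := by rwa [Function.comp_apply, e.left_inv ht]
  have heq : ((e' ∘ e.symm) ∘ (e ∘ γ)) =ᶠ[𝓝 t] e' ∘ γ := by
    filter_upwards [h.1.preimage_mem_nhds (e.open_source.mem_nhds ht)] with s hs
    exact congrArg e' (e.left_inv hs)
  have hφ : ContDiffAt ℝ 2 (e' ∘ e.symm) ((e ∘ γ) t) :=
    (contDiffAt_transition he he' hy hy').of_le (by norm_cast)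
  obtain ⟨h1, h2, -⟩ := h.2 e he ht
  rw [← heq.deriv_eq, (deriv_deriv_comp hφ h1 h2).2.2.1, h0, map_zero]

theorem Spacetime.IsGeodesicOn.eventually_chart {γ : ℝ → M} {J : Set ℝ} (h : S.IsGeodesicOn γ J)
    {t : ℝ} (ht : t ∈ J) (he : e ∈ atlas (EuclideanSpace ℝ (Fin d)) M) (hte : γ t ∈ e.source) :
    ∀ᶠ s in 𝓝 t, S.GeodesicEqAt γ s ∧ γ s ∈ e.source ∧
      HasDerivAt (e ∘ γ) (deriv (e ∘ γ) s) s ∧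
      HasDerivAt (deriv (e ∘ γ)) (spray (S.chartForm e) (e (γ s)) (deriv (e ∘ γ) s)) s := by
  have hc : ContinuousAt γ t := (h t ht).self_of_nhds.1
  filter_upwards [h t ht, hc.preimage_mem_nhds (e.open_source.mem_nhds hte)] with s hs hs'
  have := (S.chartGeodesicEqAt_iff he hs').mp (hs.chart S he hs')
  exact ⟨hs, hs', this.1.self_of_nhds, this.2⟩

/-- The stationary times form an open set by `eventually_speed_eq_zero`, the others by continuity,
and J is connected. This supplies the nonzero speed by which the estimate divides. -/
theorem Spacetime.IsGeodesicOn.not_isStationaryAt {γ : ℝ → M} {J : Set ℝ}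
    (h : S.IsGeodesicOn γ J) (hJ : IsPreconnected J) {t₀ : ℝ} (ht₀ : t₀ ∈ J)
    (h0 : ¬ IsStationaryAt d γ t₀) {t : ℝ} (ht : t ∈ J) : ¬ IsStationaryAt d γ t := by
  have key : ∀ s ∈ J, (¬ IsStationaryAt d γ s → ∀ᶠ r in 𝓝 s, ¬ IsStationaryAt d γ r) ∧
      (IsStationaryAt d γ s → ∀ᶠ r in 𝓝 s, IsStationaryAt d γ r) := by
    intro s hs
    set e := chartAt (EuclideanSpace ℝ (Fin d)) (γ s) with he_def
    have he : e ∈ atlas (EuclideanSpace ℝ (Fin d)) M := chart_mem_atlas _ _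
    have hse : γ s ∈ e.source := mem_chart_source _ _
    have hev := h.eventually_chart S hs he hse
    constructor
    · intro hns
      have hne : deriv (e ∘ γ) s ≠ 0 := fun h0 ↦ hns ⟨e, he, hse, h0⟩
      filter_upwards [hev, hev.self_of_nhds.2.2.2.continuousAt.eventually_ne hne] with r hr hr'
      exact fun hst ↦ hr' (hr.1.deriv_eq_zero S hst he hr.2.1)
    · intro hst
      have hzero := hev.self_of_nhds.1.deriv_eq_zero S hst he hse
      obtain ⟨C, hC⟩ := norm_spray_le (S.contDiffAt_chartForm he (e.map_source hse))
        (S.chartForm_injective he (e.map_source hse))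
      have hcont : ContinuousAt (e ∘ γ) s := hev.self_of_nhds.2.2.1.continuousAt
      have := eventually_speed_eq_zero (C := C) hzero (hev.mono fun r hr ↦ hr.2.2.2)
        ((hcont.eventually hC).mono fun r hr ↦ hr _)
      filter_upwards [hev, this] with r hr hr'
      exact ⟨e, he, hr.2.1, hr'⟩
  have hsub := hJ.subset_left_of_subset_union
    (u := {s | ∀ᶠ r in 𝓝 s, ¬ IsStationaryAt d γ r})
    (v := {s | ∀ᶠ r in 𝓝 s, IsStationaryAt d γ r})
    isOpen_setOfPred_eventually_nhds isOpen_setOfPred_eventually_nhds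
    (Set.disjoint_left.mpr fun s hs hs' ↦ hs.self_of_nhds hs'.self_of_nhds)
    (fun s hs ↦ (em (IsStationaryAt d γ s)).elim (fun h' ↦ Or.inr ((key s hs).2 h'))
      fun h' ↦ Or.inl ((key s hs).1 h'))
    ⟨t₀, ht₀, (key t₀ ht₀).1 h0⟩
  exact (hsub ht).self_of_nhds

theorem Spacetime.GeodesicEqAt.velocity_eq_zero {γ : ℝ → M} {t : ℝ} (h : S.GeodesicEqAt γ t)
    (hs : IsStationaryAt d γ t) : (velocity d γ t).snd = 0 := by
  obtain ⟨e, he, ht, h0⟩ := hs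
  have hM : IsManifold (𝓡 d) 1 M := IsManifold.of_le (n := ∞) (by simp)
  have heq : γ =ᶠ[𝓝 t] e.symm ∘ (e ∘ γ) := by
    filter_upwards [h.1.preimage_mem_nhds (e.open_source.mem_nhds ht)] with s hs
    exact (e.left_inv hs).symm
  have h1 : DifferentiableAt ℝ (e ∘ γ) t := (h.2 e he ht).1.self_of_nhds
  have h2 : MDifferentiableAt (𝓡 d) (𝓡 d) e.symm ((e ∘ γ) t) :=
    ((contMDiffOn_chart_symm he).contMDiffAt
      (e.open_target.mem_nhds (e.map_source ht))).mdifferentiableAt (by simp)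
  have h3 := heq.mfderiv_eq (I := 𝓘(ℝ, ℝ)) (I' := 𝓡 d)
  rw [mfderiv_comp t h2 h1.mdifferentiableAt, mfderiv_eq_fderiv] at h3
  have h4 : fderiv ℝ (e ∘ γ) t 1 = 0 := by rw [fderiv_apply_one_eq_deriv, h0]
  have h5 := congrArg (fun A ↦ A ((NormedSpace.fromTangentSpace t).symm (1 : ℝ))) h3
  exact h5.trans ((congrArg (mfderiv (𝓡 d) (𝓡 d) e.symm ((e ∘ γ) t)) h4).trans (map_zero _))

theorem isPreconnected_openInterval (a b : EReal) : IsPreconnected (openInterval a b) :=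
  Set.OrdConnected.isPreconnected ⟨fun _ hx _ hy _ hz ↦
    ⟨hx.1.trans_le (EReal.coe_le_coe_iff.mpr hz.1), (EReal.coe_le_coe_iff.mpr hz.2).trans_lt hy.2⟩⟩

theorem isOpen_openInterval (a b : EReal) : IsOpen (openInterval a b) :=
  (isOpen_Ioo (a := a) (b := b)).preimage continuous_coe_real_ereal

/-- An inextendible geodesic which is not constant does not converge in the spacetime. -/
theorem Spacetime.IsGeodesicWithData.not_tendsto {Y : TangentBundle (𝓡 d) M} {γ : ℝ → M}
    {a b : EReal} (h : S.IsGeodesicWithData Y γ a b) (hY : S.IsTimelike Y) (x : M) :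
    ¬ Tendsto γ (leftOf b) (𝓝 x) := by
  obtain ⟨ha, hb, ⟨hγ, hmax⟩, rfl⟩ := h
  intro hx
  have h0J : (0 : ℝ) ∈ openInterval a b := ⟨by exact_mod_cast ha, by exact_mod_cast hb⟩
  have h0 : ¬ IsStationaryAt d γ 0 := fun hs ↦ by
    have h1 := (hγ 0 h0J).self_of_nhds.velocity_eq_zero S hs
    rw [IsTimelike, h1, map_zero] at hY
    exact lt_irrefl _ hY
  set e := chartAt (EuclideanSpace ℝ (Fin d)) x with he_def
  have he : e ∈ atlas (EuclideanSpace ℝ (Fin d)) M := chart_mem_atlas _ _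
  have hxe : x ∈ e.source := mem_chart_source _ _
  obtain ⟨t₁, ht₁, ht₁b, hsrc⟩ := (mem_leftOf_iff hb).mp
    (hx.eventually (e.open_source.mem_nhds hxe))
  have hJ : ∀ t : ℝ, t₁ ≤ t → (t : EReal) < b → t ∈ openInterval a b := fun t ht htb ↦
    ⟨ha.trans (ht₁.trans_le (EReal.coe_le_coe_iff.mpr ht)), htb⟩
  have hev := fun (t : ℝ) (ht : t₁ ≤ t) (htb : (t : EReal) < b) ↦
    (hγ.eventually_chart S (hJ t ht htb) he (hsrc t ht htb)).self_of_nhds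
  obtain ⟨C, hC⟩ := norm_spray_le (S.contDiffAt_chartForm he (e.map_source hxe))
    (S.chartForm_injective he (e.map_source hxe))
  obtain ⟨β, rfl, ε, c, y, hε, hcβ, hcγ, hcy⟩ := exists_extension_of_tendsto (x := e x)
    (contDiffAt_spray (S.contDiffAt_chartForm he (e.map_source hxe))
      (S.chartForm_injective he (e.map_source hxe))) hC ht₁b
    (c := e ∘ γ) (fun t ht htb ↦ (hev t ht htb).2.2.1) (fun t ht htb ↦ (hev t ht htb).2.2.2)
    (fun t ht htb h' ↦ hγ.not_isStationaryAt S (isPreconnected_openInterval a _) h0J h0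
      (hJ t ht htb) ⟨e, he, hsrc t ht htb, h'⟩)
    ((e.continuousAt hxe).tendsto.comp hx)
  simp only [EReal.coe_lt_coe_iff] at *
  have hcont : ContinuousAt c β := (hcy β ⟨ht₁b, by linarith⟩).1.continuousAt
  obtain ⟨δ, hδ, hδc⟩ := Metric.eventually_nhds_iff_ball.mp
    (hcont.eventually (e.open_target.mem_nhds (by rw [hcβ]; exact e.map_source hxe)))
  rw [Real.ball_eq_Ioo] at hδc
  -- The continued solution must also stay in the range of the chart.
  set η := min ε δ with hη
  have hη0 : 0 < η := lt_min hε hδ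
  have htarget : ∀ t ∈ Ioo t₁ (β + η), c t ∈ e.target := by
    intro t ht
    rcases lt_or_ge t β with htβ | htβ
    · rw [hcγ ⟨ht.1.le, htβ⟩]
      exact e.map_source (hsrc t ht.1.le htβ)
    · exact hδc t ⟨by linarith, ht.2.trans_le (by linarith [min_le_right ε δ])⟩
  -- From β on the continuation is used, at β itself too, where the value of γ is arbitrary. This σ
  -- extends γ beyond β and contradicts inextendibility.
  let σ : ℝ → M := fun t ↦ if t < β then γ t else e.symm (c t)
  have hσ1 : ∀ t < β, σ t = γ t := fun t ht ↦ if_pos ht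
  have hσ2 : ∀ t ∈ Ioo t₁ (β + η), σ t = e.symm (c t) := by
    intro t ht
    rcases lt_or_ge t β with htβ | htβ
    · rw [hσ1 t htβ, hcγ ⟨ht.1.le, htβ⟩]
      exact (e.left_inv (hsrc t ht.1.le htβ)).symm
    · exact if_neg htβ.not_gt
  have hσe : ∀ t ∈ Ioo t₁ (β + η), (e ∘ σ) t = c t := fun t ht ↦ by
    rw [Function.comp_apply, hσ2 t ht, e.right_inv (htarget t ht)]
  have hgeo : S.IsGeodesicOn σ (openInterval a ((β + η : ℝ) : EReal)) := by
    refine IsGeodesicOn.of_forall S (isOpen_openInterval _ _) fun t ht ↦ ?_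
    have htη : t < β + η := EReal.coe_lt_coe_iff.mp ht.2
    rcases lt_or_ge t β with htβ | htβ
    · refine (hγ t ⟨ht.1, EReal.coe_lt_coe_iff.mpr htβ⟩).self_of_nhds.congr S ?_
      filter_upwards [Iio_mem_nhds htβ] with s hs using hσ1 s hs
    · have htI : t ∈ Ioo t₁ (β + η) := ⟨by linarith, htη⟩
      have hnear : ∀ᶠ s in 𝓝 t, s ∈ Ioo t₁ (β + η) := isOpen_Ioo.mem_nhds htI
      have hσt : σ t ∈ e.source := by
        rw [hσ2 t htI]
        exact e.map_target (htarget t htI)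
      have hcy' : ∀ s ∈ Ioo t₁ (β + η), HasDerivAt c (y s) s ∧
          HasDerivAt y (spray (S.chartForm e) (c s) (y s)) s := fun s hs ↦
        hcy s ⟨hs.1, hs.2.trans_le (by linarith [min_le_left ε δ])⟩
      have hcontσ : ContinuousAt σ t := by
        have h1 : ContinuousAt (e.symm ∘ c) t := ContinuousAt.comp
          (e.continuousAt_symm (htarget t htI)) (hcy' t htI).1.continuousAt
        refine h1.congr ?_
        filter_upwards [hnear] with s hs using (hσ2 s hs).symm
      have heq : e ∘ σ =ᶠ[𝓝 t] c := hnear.mono hσe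
      have hder : deriv (e ∘ σ) =ᶠ[𝓝 t] y := by
        filter_upwards [hnear, heq.eventuallyEq_nhds] with s hs hs'
        rw [hs'.deriv_eq, (hcy' s hs).1.deriv]
      refine GeodesicEqAt.of_chart S ((S.chartGeodesicEqAt_iff he hσt).mpr ⟨?_, ?_⟩) hcontσ he hσt
      · filter_upwards [hnear, heq.eventuallyEq_nhds] with s hs hs'
        exact ((hcy' s hs).1.congr_of_eventuallyEq hs').differentiableAt.hasDerivAt
      · have hσt' : e (σ t) = c t := hσe t htI
        rw [hσt', hder.self_of_nhds]
        exact (hcy' t htI).2.congr_of_eventuallyEq hder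
  have := (hmax σ a _ le_rfl (EReal.coe_le_coe_iff.mpr (by linarith)) hgeo
    fun t ht ↦ hσ1 t (EReal.coe_lt_coe_iff.mp ht.2)).2
  linarith [EReal.coe_eq_coe_iff.mp this]

end Extension

/-! ### Extension of geodesics to inextendible ones, and shifts of the parameter. -/

section Inextendible

variable {d : ℕ} {M : Type u} [TopologicalSpace M]
  [ChartedSpace (EuclideanSpace ℝ (Fin d)) M]

theorem tangent_mk_eq {p q : M} {v w : EuclideanSpace ℝ (Fin d)} (hpq : p = q) (hvw : v = w) :
    (⟨p, v⟩ : TangentBundle (𝓡 d) M) = ⟨q, w⟩ := by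
  subst hpq hvw
  rfl

theorem velocity_congr {γ σ : ℝ → M} {t : ℝ} (h : σ =ᶠ[𝓝 t] γ) :
    velocity d σ t = velocity d γ t :=
  tangent_mk_eq h.self_of_nhds (congrArg
    (fun A : ℝ →L[ℝ] EuclideanSpace ℝ (Fin d) ↦ A 1) (h.mfderiv_eq (I := 𝓘(ℝ, ℝ)) (I' := 𝓡 d)))

variable [IsManifold (𝓡 d) ∞ M] (S : Spacetime d M)

theorem openInterval_subset {a b a' b' : EReal} (ha : a' ≤ a) (hb : b ≤ b') :
    openInterval a b ⊆ openInterval a' b' := fun _ ht ↦ ⟨ha.trans_lt ht.1, ht.2.trans_le hb⟩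

/-- Every geodesic on an open interval extends to an inextendible geodesic. -/
theorem Spacetime.IsGeodesicOn.exists_isInextendibleGeodesic {γ : ℝ → M} {a b : EReal}
    (hγ : S.IsGeodesicOn γ (openInterval a b)) :
    ∃ (σ : ℝ → M) (a' b' : EReal), a' ≤ a ∧ b ≤ b' ∧ S.IsInextendibleGeodesic σ a' b' ∧
      EqOn σ γ (openInterval a b) := by
  -- Zorn's lemma is applied to a preorder only: curves may differ outside their intervals, so
  -- mutual extension is not equality.
  let T := {p : (ℝ → M) × EReal × EReal // S.IsGeodesicOn p.1 (openInterval p.2.1 p.2.2)}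
  let r : T → T → Prop := fun p q ↦ q.1.2.1 ≤ p.1.2.1 ∧ p.1.2.2 ≤ q.1.2.2 ∧
    EqOn q.1.1 p.1.1 (openInterval p.1.2.1 p.1.2.2)
  have hrefl : ∀ p, r p p := fun p ↦ ⟨le_rfl, le_rfl, fun _ _ ↦ rfl⟩
  have htrans : ∀ {p q s : T}, r p q → r q s → r p s := fun {p q s} h h' ↦
    ⟨h'.1.trans h.1, h.2.1.trans h'.2.1, fun t ht ↦
      (h'.2.2 (openInterval_subset h.1 h.2.1 ht)).trans (h.2.2 ht)⟩
  let p₀ : T := ⟨(γ, a, b), hγ⟩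
  let T' := {p : T // r p₀ p}
  let r' : T' → T' → Prop := fun p q ↦ r p.1 q.1
  have : Nonempty T' := ⟨⟨p₀, hrefl p₀⟩⟩
  obtain ⟨m, hm⟩ : ∃ m : T', ∀ q, r' m q → r' q m := by
    refine exists_maximal_of_nonempty_chains_bounded (fun c hc hne ↦ ?_) (fun h h' ↦ htrans h h')
    have htot : ∀ p ∈ c, ∀ q ∈ c, r' p q ∨ r' q p := fun p hp q hq ↦ by
      by_cases hpq : p = q
      · subst hpq
        exact Or.inl (hrefl _)
      · exact hc hp hq hpq
    let a' : EReal := ⨅ p : c, p.1.1.1.2.1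
    let b' : EReal := ⨆ p : c, p.1.1.1.2.2
    have hcov : ∀ t ∈ openInterval a' b', ∃ p ∈ c, t ∈ openInterval p.1.1.2.1 p.1.1.2.2 := by
      intro t ht
      obtain ⟨⟨p, hp⟩, hpt⟩ := iInf_lt_iff.mp ht.1
      obtain ⟨⟨q, hq⟩, hqt⟩ := lt_iSup_iff.mp ht.2
      rcases htot p hp q hq with h | h
      · exact ⟨q, hq, h.1.trans_lt hpt, hqt⟩
      · exact ⟨p, hp, hpt, hqt.trans_le h.2.1⟩
    have hchoose : ∀ t : ℝ, ∃ x : M, ∀ p ∈ c, t ∈ openInterval p.1.1.2.1 p.1.1.2.2 →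
        x = p.1.1.1 t := by
      intro t
      by_cases h : ∃ p ∈ c, t ∈ openInterval p.1.1.2.1 p.1.1.2.2
      · obtain ⟨p, hp, hpt⟩ := h
        refine ⟨p.1.1.1 t, fun q hq hqt ↦ ?_⟩
        rcases htot p hp q hq with h | h
        · exact (h.2.2 hpt).symm
        · exact h.2.2 hqt
      · exact ⟨γ t, fun p hp hpt ↦ (h ⟨p, hp, hpt⟩).elim⟩
    choose σ hσ using hchoose
    have hgeo : S.IsGeodesicOn σ (openInterval a' b') := by
      intro t ht
      obtain ⟨p, hp, hpt⟩ := hcov t ht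
      refine p.1.2.congr S (fun s hs ↦ ?_) t hpt
      filter_upwards [(isOpen_openInterval _ _).mem_nhds hs] with q hq using hσ q p hp hq
    have hub : ∀ p ∈ c, r p.1 ⟨(σ, a', b'), hgeo⟩ := fun p hp ↦
      ⟨iInf_le (fun p : c ↦ p.1.1.1.2.1) ⟨p, hp⟩, le_iSup (fun p : c ↦ p.1.1.1.2.2) ⟨p, hp⟩,
        fun t ht ↦ hσ t p hp ht⟩
    obtain ⟨p, hp⟩ := hne
    exact ⟨⟨⟨(σ, a', b'), hgeo⟩, htrans p.2 (hub p hp)⟩, fun q hq ↦ hub q hq⟩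
  refine ⟨m.1.1.1, m.1.1.2.1, m.1.1.2.2, m.2.1, m.2.2.1, ⟨m.1.2, ?_⟩, m.2.2.2⟩
  intro σ a' b' ha hb hσ heq
  have h1 : r m.1 ⟨(σ, a', b'), hσ⟩ := ⟨ha, hb, heq⟩
  have h2 := hm ⟨⟨(σ, a', b'), hσ⟩, htrans m.2 h1⟩ h1
  exact ⟨le_antisymm ha h2.1, le_antisymm h2.2.1 hb⟩

theorem Spacetime.GeodesicEqAt.mdifferentiableAt {γ : ℝ → M} {t : ℝ} (h : S.GeodesicEqAt γ t) :
    MDifferentiableAt 𝓘(ℝ, ℝ) (𝓡 d) γ t := by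
  set e := chartAt (EuclideanSpace ℝ (Fin d)) (γ t)
  have he : e ∈ atlas (EuclideanSpace ℝ (Fin d)) M := chart_mem_atlas _ _
  have ht : γ t ∈ e.source := mem_chart_source _ _
  have heq : γ =ᶠ[𝓝 t] e.symm ∘ (e ∘ γ) := by
    filter_upwards [h.1.preimage_mem_nhds (e.open_source.mem_nhds ht)] with s hs
    exact (e.left_inv hs).symm
  have h1 : DifferentiableAt ℝ (e ∘ γ) t := (h.2 e he ht).1.self_of_nhds
  have h2 : MDifferentiableAt (𝓡 d) (𝓡 d) e.symm ((e ∘ γ) t) :=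
    ((contMDiffOn_chart_symm he).contMDiffAt
      (e.open_target.mem_nhds (e.map_source ht))).mdifferentiableAt (by simp)
  exact (h2.comp t h1.mdifferentiableAt).congr_of_eventuallyEq heq

theorem Spacetime.GeodesicEqAt.velocity_add_const {γ : ℝ → M} {s t : ℝ}
    (h : S.GeodesicEqAt γ (t + s)) :
    velocity d (fun r ↦ γ (r + s)) t = velocity d γ (t + s) := by
  refine tangent_mk_eq rfl ?_
  have h1 : HasFDerivAt (fun r : ℝ ↦ r + s) (ContinuousLinearMap.id ℝ ℝ) t :=
    (hasFDerivAt_id t).add_const s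
  have h2 := mfderiv_comp (I := 𝓘(ℝ, ℝ)) (I' := 𝓘(ℝ, ℝ)) (I'' := 𝓡 d) (f := fun r : ℝ ↦ r + s)
    (g := γ) t h.mdifferentiableAt h1.differentiableAt.mdifferentiableAt
  rw [mfderiv_eq_fderiv, h1.fderiv] at h2
  exact congrArg (fun A : ℝ →L[ℝ] EuclideanSpace ℝ (Fin d) ↦ A 1) h2

theorem Spacetime.GeodesicEqAt.add_const {γ : ℝ → M} {s t : ℝ} (h : S.GeodesicEqAt γ (t + s)) :
    S.GeodesicEqAt (fun r ↦ γ (r + s)) t := by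
  have hadd : Tendsto (fun r : ℝ ↦ r + s) (𝓝 t) (𝓝 (t + s)) :=
    (continuous_add_const s).tendsto t
  refine ⟨ContinuousAt.comp (f := fun r : ℝ ↦ r + s) h.1 hadd, fun e he ht ↦ ?_⟩
  obtain ⟨h1, h2, h3⟩ := h.2 e he ht
  have hd : deriv (e ∘ fun r ↦ γ (r + s)) = fun r ↦ deriv (e ∘ γ) (r + s) := by
    ext1 r
    exact deriv_comp_add_const (f := e ∘ γ) s r
  have hdd : deriv (fun r ↦ deriv (e ∘ γ) (r + s)) t = deriv (deriv (e ∘ γ)) (t + s) :=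
    deriv_comp_add_const (f := deriv (e ∘ γ)) s t
  rw [hd, hdd]
  refine ⟨?_, ?_, h3⟩
  · filter_upwards [hadd.eventually h1] with r hr
    exact (differentiableAt_comp_add_const (f := e ∘ γ)).mpr hr
  · exact (differentiableAt_comp_add_const (f := deriv (e ∘ γ))).mpr h2

/-- The final segments of a future directed timelike geodesic without end point in the spacetime
are final segments of inextendible geodesics. -/
theorem Spacetime.IsFutureTimelikeGeodesic.exists_isGeodesicWithData {γ : ℝ → M}
    (hγ : S.IsFutureTimelikeGeodesic γ) (hlim : ∀ x, ¬ Tendsto γ (𝓝[<] 1) (𝓝 x))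
    {s : ℝ} (hs : s ∈ Ico (0 : ℝ) 1) : ∃ (σ : ℝ → M) (a : EReal),
      S.IsGeodesicWithData (velocity d γ s) σ a ((1 - s : ℝ) : EReal) ∧
      ∀ t ∈ Ico 0 (1 - s), σ t = γ (t + s) ∧ velocity d σ t = velocity d γ (t + s) := by
  -- Being a geodesic at 0 means being one near 0, so γ is a geodesic on (-ε, 1); this gives an
  -- interval containing 0 in its interior even for s = 0.
  obtain ⟨ε, hε, hε0⟩ := Metric.eventually_nhds_iff_ball.mp (hγ.1 0 ⟨le_rfl, one_pos⟩)
  rw [Real.ball_eq_Ioo] at hε0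
  have hgeo : ∀ t ∈ Ioo (-ε) 1, S.GeodesicEqAt γ t := by
    intro t ht
    rcases lt_or_ge t 0 with h0 | h0
    · exact hε0 t ⟨by linarith [ht.1], by linarith⟩
    · exact (hγ.1 t ⟨h0, ht.2⟩).self_of_nhds
  have hgeo' : S.IsGeodesicOn (fun r ↦ γ (r + s))
      (openInterval ((-ε - s : ℝ) : EReal) ((1 - s : ℝ) : EReal)) := by
    refine IsGeodesicOn.of_forall S (isOpen_openInterval _ _) fun t ht ↦ ?_
    have h1 := EReal.coe_lt_coe_iff.mp ht.1
    have h2 := EReal.coe_lt_coe_iff.mp ht.2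
    exact (hgeo (t + s) ⟨by linarith, by linarith⟩).add_const S
  obtain ⟨σ, a, b, ha, hb, hσ, heq⟩ := hgeo'.exists_isInextendibleGeodesic S
  have hmem : ∀ t : ℝ, -ε - s < t → t < 1 - s →
      t ∈ openInterval ((-ε - s : ℝ) : EReal) ((1 - s : ℝ) : EReal) := fun t h h' ↦
    ⟨EReal.coe_lt_coe_iff.mpr h, EReal.coe_lt_coe_iff.mpr h'⟩
  have hs0 := hs.1
  have hs1 := hs.2
  have hvel : ∀ t ∈ Ico 0 (1 - s), velocity d σ t = velocity d γ (t + s) := by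
    intro t ht
    have htm := hmem t (by linarith [ht.1]) ht.2
    rw [← (hgeo (t + s) ⟨by linarith [ht.1], by linarith [ht.2]⟩).velocity_add_const S]
    refine velocity_congr ?_
    filter_upwards [(isOpen_openInterval _ _).mem_nhds htm] with r hr using heq hr
  -- If the extension lived beyond 1 - s, it would be continuous there and γ would have a limit in
  -- M.
  have hb' : b = ((1 - s : ℝ) : EReal) := by
    by_contra hne
    have hlt : ((1 - s : ℝ) : EReal) < b := lt_of_le_of_ne hb (Ne.symm hne)
    have h1 : (1 - s) ∈ openInterval a b :=
      ⟨ha.trans_lt (EReal.coe_lt_coe_iff.mpr (by linarith)), hlt⟩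
    have h2 : Tendsto σ (𝓝 (1 - s)) (𝓝 (σ (1 - s))) := (hσ.1 _ h1).self_of_nhds.1
    have h3 : Tendsto (fun t : ℝ ↦ t - s) (𝓝[<] 1) (𝓝 (1 - s)) :=
      ((continuous_sub_right s).tendsto 1).mono_left nhdsWithin_le_nhds
    refine hlim (σ (1 - s)) ((h2.comp h3).congr' ?_)
    filter_upwards [Ioo_mem_nhdsLT one_pos] with t ht
    rw [Function.comp_apply, heq (hmem (t - s) (by linarith [ht.1]) (by linarith [ht.2]))]
    simp
  subst hb'
  refine ⟨σ, a, ⟨ha.trans_lt ?_, ?_, hσ, ?_⟩, fun t ht ↦ ⟨?_, hvel t ht⟩⟩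
  · exact_mod_cast (by linarith : -ε - s < 0)
  · exact_mod_cast (by linarith : 0 < 1 - s)
  · simpa using hvel 0 ⟨le_rfl, by linarith⟩
  · exact heq (hmem t (by linarith [ht.1]) ht.2)

end Inextendible

/-! ### Traces of points of extensions as filters on M. -/

section Trace

variable {d : ℕ} [NeZero d] {M : Type u} [TopologicalSpace M]
  [ChartedSpace (EuclideanSpace ℝ (Fin d)) M] [IsManifold (𝓡 d) ∞ M]
  {S : Spacetime d M} {h : TangentDistance d M}

namespace RegularExtension

variable (A B : RegularExtension.{u, v} S h)

/-- The trace on `M` of the neighbourhoods of a point of an extension. -/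
def trace (p : A.N) : Filter M := comap A.ι (𝓝 p)

theorem not_mem_range_iff {p : A.N} : p ∉ range A.ι ↔ p ∈ (𝓡∂ d).boundary A.N := by
  rw [A.range_eq, ← ModelWithCorners.compl_interior, mem_compl_iff]

theorem denseRange : DenseRange A.ι := by
  intro p
  by_cases hp : p ∈ range A.ι
  · exact subset_closure hp
  · obtain ⟨γ, -, hγ⟩ := A.exists_curve p (A.not_mem_range_iff.mp hp)
    exact mem_closure_of_tendsto hγ (Eventually.of_forall fun t ↦ mem_range_self _)

instance trace_neBot (p : A.N) : (A.trace p).NeBot :=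
  comap_neBot_iff.mpr fun t ht ↦ by
    obtain ⟨_, hpt, x, rfl⟩ := mem_closure_iff_nhds.mp (A.denseRange p) t ht
    exact ⟨x, hpt⟩

theorem trace_apply (x : M) : A.trace (A.ι x) = 𝓝 x :=
  (A.isEmbedding.isInducing.nhds_eq_comap x).symm

theorem tendsto_trace_iff {α : Type*} {l : Filter α} {f : α → M} {p : A.N} :
    Tendsto f l (A.trace p) ↔ Tendsto (A.ι ∘ f) l (𝓝 p) := tendsto_comap_iff

instance locallyCompactSpace : LocallyCompactSpace A.N :=
  Manifold.locallyCompact_of_finiteDimensional (𝓡∂ d)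

/-- Continuity holds because a neighbourhood of p is a neighbourhood of all nearby points.
Conversely, for a closed neighbourhood W of p, any q whose trace contains `ι⁻¹ W` is a limit of
points of W, so it lies in W. -/
theorem isEmbedding_trace : IsEmbedding A.trace := by
  have hind : IsInducing A.trace := by
    refine isInducing_iff_nhds.mpr fun p ↦ le_antisymm ?_ ?_
    · rw [← tendsto_iff_comap, Filter.tendsto_nhds]
      rintro s ⟨V, hV, hVs⟩
      filter_upwards [eventually_mem_nhds_iff.mpr hV] with q hq using ⟨V, hq, hVs⟩
    · intro V hV
      obtain ⟨W, hW, hWc, hWV⟩ := exists_mem_nhds_isClosed_subset hV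
      refine ⟨{F | A.ι ⁻¹' W ∈ F}, isOpen_setOfPred_mem.mem_nhds (preimage_mem_comap hW),
        fun q hq ↦ hWV ?_⟩
      have hmap : Tendsto A.ι (A.trace q) (𝓝 q) := tendsto_comap
      exact hWc.mem_of_tendsto hmap hq
  exact ⟨hind, hind.injective⟩

variable {A B}

theorem disjoint_trace {p q : A.N} (hpq : p ≠ q) : Disjoint (A.trace p) (A.trace q) :=
  disjoint_comap (disjoint_nhds_nhds.mpr hpq)

/-! ### Thickenings -/

/-- A limit in M is impossible for an inextendible timelike geodesic, so the boundary thickening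
adds nothing over M. -/
theorem preimage_boundaryThickening {X : TangentBundle (𝓡 d) M} {r : ℝ} :
    A.ι ⁻¹' S.boundaryThickening h A.ι X r = ∅ := by
  refine eq_empty_of_forall_notMem ?_
  rintro x ⟨Y, -, hY, γ, a, b, hγ, hx⟩
  rw [← A.tendsto_trace_iff, trace_apply] at hx
  exact hγ.not_tendsto S hY x hx

theorem preimage_thickeningIn {X : TangentBundle (𝓡 d) M} {r : ℝ} :
    A.ι ⁻¹' S.thickeningIn h A.ι X r = S.thickening h X r := by
  rw [Spacetime.thickeningIn, preimage_union, preimage_boundaryThickening, union_empty,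
    preimage_image_eq _ A.isEmbedding.injective]

/-- A geodesic converging to a boundary point has no limit in the spacetime. -/
theorem not_tendsto_of_boundary {p : A.N} (hp : p ∉ range A.ι) {γ : ℝ → M}
    (hγ : Tendsto γ (𝓝[<] 1) (A.trace p)) (x : M) : ¬ Tendsto γ (𝓝[<] 1) (𝓝 x) := by
  intro hx
  rw [← A.trace_apply] at hx
  have hne : p ≠ A.ι x := fun h0 ↦ hp (h0 ▸ mem_range_self x)
  exact hγ.not_tendsto (disjoint_trace hne) hx

/-- The inextendible geodesic with initial velocity γ'(s) follows γ to p, so p belongs to the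
boundary thickening; openness of O^N then puts O^M in the trace. -/
theorem thickening_mem_trace {p : A.N} (hp : p ∉ range A.ι) {γ : ℝ → M}
    (hγ : S.IsFutureTimelikeGeodesic γ) (hγp : Tendsto γ (𝓝[<] 1) (A.trace p))
    {s : ℝ} (hs : s ∈ Ico (0 : ℝ) 1) {X : TangentBundle (𝓡 d) M} (hX : S.IsTimelike X) {r : ℝ}
    (hr : 0 < r) (hXr : velocity d γ s ∈ h.ball X r) : S.thickening h X r ∈ A.trace p := by
  rw [← A.preimage_thickeningIn]
  refine preimage_mem_comap ((A.isOpen_thickening X r hX hr).mem_nhds (Or.inr ?_))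
  obtain ⟨σ, a, hσ, hσγ⟩ :=
    hγ.exists_isGeodesicWithData S (not_tendsto_of_boundary hp hγp) hs
  refine ⟨_, hXr, (hγ.2 s hs).1, σ, a, _, hσ, ?_⟩
  rw [leftOf_coe]
  have h1 : Tendsto (fun t : ℝ ↦ t + s) (𝓝[<] (1 - s)) (𝓝[<] 1) := by
    refine tendsto_nhdsWithin_of_tendsto_nhds_of_eventually_within _ ?_ ?_
    · have := (continuous_add_const s).tendsto (1 - s)
      rw [sub_add_cancel] at this
      exact this.mono_left nhdsWithin_le_nhds
    · filter_upwards [self_mem_nhdsWithin] with t ht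
      have : t < 1 - s := ht
      exact show t + s < 1 by linarith
  refine ((A.tendsto_trace_iff.mp hγp).comp h1).congr' ?_
  filter_upwards [Ioo_mem_nhdsLT (show (0 : ℝ) < 1 - s by linarith [hs.2])] with t ht
  exact congrArg A.ι (hσγ t ⟨ht.1.le, ht.2⟩).1.symm

/-- The basis is described by M and γ alone, which makes traces from different extensions
comparable. -/
theorem trace_hasBasis {p : A.N} (hp : p ∉ range A.ι) {γ : ℝ → M}
    (hγ : S.IsFutureTimelikeGeodesic γ) (hγp : Tendsto γ (𝓝[<] 1) (A.trace p)) :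
    (A.trace p).HasBasis (fun k : ℕ × ℕ ↦ 0 < k.1 ∧ 0 < k.2)
      (fun k ↦ S.thickening h (velocity d γ (1 - 1 / (k.1 : ℝ))) (1 / (k.2 : ℝ))) := by
  have h1 := (A.nhds_basis p (A.not_mem_range_iff.mp hp) γ hγ (A.tendsto_trace_iff.mp hγp)).comap
    A.ι
  rw [trace]
  simpa only [preimage_thickeningIn] using h1

theorem one_sub_inv_mem_Ico {n : ℕ} (hn : 0 < n) : 1 - 1 / (n : ℝ) ∈ Ico (0 : ℝ) 1 := by
  have h1 : (1 : ℝ) ≤ n := by exact_mod_cast hn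
  have h2 : 1 / (n : ℝ) ≤ 1 := (div_le_one (by linarith)).mpr h1
  have h3 : 0 < 1 / (n : ℝ) := by positivity
  exact ⟨by linarith, by linarith⟩

/-- The trace of the limit of a geodesic depends only on the geodesic. -/
theorem trace_eq_of_tendsto {p : A.N} {q : B.N} {γ : ℝ → M} (hγ : S.IsFutureTimelikeGeodesic γ)
    (hp : Tendsto γ (𝓝[<] 1) (A.trace p)) (hq : Tendsto γ (𝓝[<] 1) (B.trace q)) :
    A.trace p = B.trace q := by
  by_cases hpA : p ∈ range A.ι
  · obtain ⟨x, rfl⟩ := hpA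
    rw [trace_apply] at hp ⊢
    by_cases hqB : q ∈ range B.ι
    · obtain ⟨y, rfl⟩ := hqB
      rw [← B.trace_apply] at hp
      rw [← B.trace_apply]
      by_contra hne
      exact hp.not_tendsto (disjoint_trace fun h0 ↦ hne (by rw [h0])) hq
    · exact (not_tendsto_of_boundary hqB hq x hp).elim
  · by_cases hqB : q ∈ range B.ι
    · obtain ⟨y, rfl⟩ := hqB
      rw [trace_apply] at hq
      exact (not_tendsto_of_boundary hpA hp y hq).elim
    · exact (trace_hasBasis hpA hγ hp).eq_of_same_basis (trace_hasBasis hqB hγ hq)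

/-- Without intertwined geodesics, the traces of the end points of two geodesics are disjoint or
equal. -/
theorem disjoint_trace_or_tendsto (hS : ¬ S.HasIntertwinedGeodesics h) {p : A.N} {q : B.N}
    (hp : p ∉ range A.ι) (hq : q ∉ range B.ι) {γ σ : ℝ → M}
    (hγ : S.IsFutureTimelikeGeodesic γ) (hσ : S.IsFutureTimelikeGeodesic σ)
    (hγp : Tendsto γ (𝓝[<] 1) (A.trace p)) (hσq : Tendsto σ (𝓝[<] 1) (B.trace q)) :
    Disjoint (A.trace p) (B.trace q) ∨ Tendsto σ (𝓝[<] 1) (A.trace p) := by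
  by_cases hdisj : Disjoint (A.trace p) (B.trace q)
  · exact Or.inl hdisj
  refine Or.inr ((trace_hasBasis hp hγ hγp).tendsto_right_iff.mpr ?_)
  rintro ⟨n, m⟩ ⟨hn, hm⟩
  have hs := one_sub_inv_mem_Ico hn
  have h0 : (0 : ℝ) ∈ Ico (0 : ℝ) 1 := ⟨le_rfl, one_pos⟩
  obtain ⟨γ', a, hγ', hγ'γ⟩ :=
    hγ.exists_isGeodesicWithData S (not_tendsto_of_boundary hp hγp) hs
  obtain ⟨σ', a', hσ', hσ'σ⟩ :=
    hσ.exists_isGeodesicWithData S (not_tendsto_of_boundary hq hσq) h0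
  have hnot : S.NotIntertwined h γ' ((1 - (1 - 1 / (n : ℝ)) : ℝ) : EReal) σ'
      ((1 - 0 : ℝ) : EReal) := by
    by_contra hcon
    exact hS ⟨_, _, γ', σ', a, _, a', _, hγ.2 _ hs, hσ.2 _ h0, hγ', hσ', hcon⟩
  rcases hnot with hnot | ⟨s₁, s₂, r, ρ, hs₁, hs₁b, hs₂, hs₂b, hr, hρ, hempty⟩
  · obtain ⟨s₁, s₂, -, -, hs₂, hs₂b, -, hsub⟩ := hnot (1 / m) 1 (by positivity) one_pos
    rw [hγ'.2.2.2] at hsub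
    have hs₂1 : s₂ < 1 := by simpa using EReal.coe_lt_coe_iff.mp hs₂b
    filter_upwards [Ioo_mem_nhdsLT hs₂1] with t ht
    have h1 := hsub t ht.1.le (EReal.coe_lt_coe_iff.mpr (by linarith [ht.2]))
    rwa [(hσ'σ t ⟨by linarith [ht.1], by linarith [ht.2]⟩).1, add_zero] at h1
  -- Disjoint thickenings of final segments belong to the two traces, which were assumed not to be
  -- disjoint.
  · exfalso
    have hs₁' := EReal.coe_lt_coe_iff.mp hs₁b
    have hs₂' := EReal.coe_lt_coe_iff.mp hs₂b
    have hball : ∀ (X : TangentBundle (𝓡 d) M) (r : ℝ), 0 < r → X ∈ h.ball X r := fun X r hr ↦ by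
      rw [TangentDistance.ball, mem_ofPred_eq, (h.dist_eq_zero X X).mpr rfl]
      exact hr
    have ht₁ : s₁ + (1 - 1 / (n : ℝ)) ∈ Ico (0 : ℝ) 1 := ⟨by linarith [hs.1], by linarith⟩
    have ht₂ : s₂ + 0 ∈ Ico (0 : ℝ) 1 := ⟨by linarith, by linarith⟩
    rw [(hγ'γ s₁ ⟨hs₁.le, hs₁'⟩).2, (hσ'σ s₂ ⟨hs₂.le, hs₂'⟩).2] at hempty
    refine hdisj (Filter.disjoint_iff.mpr ⟨_, thickening_mem_trace hp hγ hγp ht₁ (hγ.2 _ ht₁).1 hr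
      (hball _ _ hr), _, thickening_mem_trace hq hσ hσq ht₂ (hσ.2 _ ht₂).1 hρ (hball _ _ hρ),
      disjoint_iff_inter_eq_empty.mpr hempty⟩)

/-- Without intertwined geodesics, different traces are disjoint. -/
theorem disjoint_trace_of_ne (hS : ¬ S.HasIntertwinedGeodesics h) {p : A.N} {q : B.N}
    (hne : A.trace p ≠ B.trace q) : Disjoint (A.trace p) (B.trace q) := by
  by_cases hp : p ∈ range A.ι
  · obtain ⟨x, rfl⟩ := hp
    rw [trace_apply, ← B.trace_apply] at hne ⊢
    exact disjoint_trace fun h0 ↦ hne (by rw [h0])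
  by_cases hq : q ∈ range B.ι
  · obtain ⟨x, rfl⟩ := hq
    rw [trace_apply, ← A.trace_apply] at hne ⊢
    exact disjoint_trace fun h0 ↦ hne (by rw [h0])
  obtain ⟨γ, hγ, hγp⟩ := A.exists_geodesic p (A.not_mem_range_iff.mp hp)
  obtain ⟨σ, hσ, hσq⟩ := B.exists_geodesic q (B.not_mem_range_iff.mp hq)
  rw [← tendsto_trace_iff] at hγp hσq
  exact (disjoint_trace_or_tendsto hS hp hq hγ hσ hγp hσq).resolve_right fun h0 ↦
    hne (trace_eq_of_tendsto hσ h0 hσq)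

/-- Without intertwined geodesics, the traces in a neighbourhood of a trace of `A` are traces
of `A`. -/
theorem exists_mem_trace_forall (hS : ¬ S.HasIntertwinedGeodesics h) (p : A.N) :
    ∃ s ∈ A.trace p, ∀ (B : RegularExtension.{u, v} S h) (q : B.N), s ∈ B.trace q →
      B.trace q ∈ range A.trace := by
  -- If the trace of q contains `ι⁻¹ K`, a geodesic ending at q eventually stays in the compact set
  -- K and so accumulates at some p' in K. Then the traces of p' and q are not disjoint, hence
  -- equal.
  obtain ⟨K, hK, hKp⟩ := exists_compact_mem_nhds p
  refine ⟨A.ι ⁻¹' K, preimage_mem_comap hKp, fun B q hsq ↦ ?_⟩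
  by_cases hq : q ∈ range B.ι
  · obtain ⟨x, rfl⟩ := hq
    exact ⟨A.ι x, by rw [trace_apply, trace_apply]⟩
  obtain ⟨σ, hσ, hσq⟩ := B.exists_geodesic q (B.not_mem_range_iff.mp hq)
  rw [← tendsto_trace_iff] at hσq
  obtain ⟨p', -, hp'⟩ := hK (f := map (A.ι ∘ σ) (𝓝[<] 1)) (by
    rw [le_principal_iff, mem_map]
    exact hσq hsq)
  have hnd : ¬ Disjoint (A.trace p') (B.trace q) := by
    intro hd
    have h1 : Disjoint (A.trace p') (map σ (𝓝[<] 1)) := hd.mono_right hσq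
    rw [trace, disjoint_iff, ← map_eq_bot_iff (m := A.ι), inf_comm, Filter.push_pull, map_map,
      inf_comm] at h1
    exact hp'.ne h1
  have heq : A.trace p' = B.trace q := by
    by_contra hne
    exact hnd (disjoint_trace_of_ne hS hne)
  exact ⟨p', heq⟩

end RegularExtension

end Trace

/-- Countably many bundle charts suffice. The result provides a countable dense set of timelike
vectors. -/
theorem secondCountableTopology_tangentBundle {d : ℕ} {M : Type u} [TopologicalSpace M]
    [ChartedSpace (EuclideanSpace ℝ (Fin d)) M] [IsManifold (𝓡 d) ∞ M]
    [SecondCountableTopology M] : SecondCountableTopology (TangentBundle (𝓡 d) M) := by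
  have hM : IsManifold (𝓡 d) 1 M := IsManifold.of_le (n := ∞) (by simp)
  obtain ⟨s, hsc, hs⟩ := TopologicalSpace.countable_cover_nhds
    (f := fun x : M ↦ (chartAt (EuclideanSpace ℝ (Fin d)) x).source)
    fun x ↦ chart_source_mem_nhds _ x
  have hH : SecondCountableTopology
      (ModelProd (EuclideanSpace ℝ (Fin d)) (EuclideanSpace ℝ (Fin d))) :=
    inferInstanceAs (SecondCountableTopology
      (EuclideanSpace ℝ (Fin d) × EuclideanSpace ℝ (Fin d)))
  refine ChartedSpace.secondCountable_of_countable_cover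
    (ModelProd (EuclideanSpace ℝ (Fin d)) (EuclideanSpace ℝ (Fin d)))
    (s := (fun x : M ↦ (⟨x, 0⟩ : TangentBundle (𝓡 d) M)) '' s) ?_ (hsc.image _)
  refine eq_univ_of_forall fun X ↦ ?_
  obtain ⟨x, hx, hXx⟩ := mem_iUnion₂.mp (hs ▸ mem_univ X.proj)
  exact mem_iUnion₂.mpr ⟨_, mem_image_of_mem _ hx,
    (TangentBundle.mem_chart_source_iff X _).mpr hXx⟩

/-! ### The space of all traces as a regular extension. -/

section MaximalExtension

variable {d : ℕ} [NeZero d] {M : Type u} [TopologicalSpace M]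
  [ChartedSpace (EuclideanSpace ℝ (Fin d)) M] [IsManifold (𝓡 d) ∞ M]
  (S : Spacetime d M) (h : TangentDistance d M)

/-- The traces on `M` of the points of all regular future g-boundary extensions. -/
def traces : Set (Filter M) :=
  {F | ∃ (A : RegularExtension.{u, v} S h) (p : A.N), A.trace p = F}

variable {S h}

/-- One extension injects M into a type of universe v, so M and its filters are v-small; the space
of all traces can therefore serve as the underlying type of an extension. -/
theorem RegularExtension.small_traces (A : RegularExtension.{u, v} S h) :
    Small.{v} (traces.{u, v} S h) := by
  have h1 : Small.{v} M := small_of_injective A.isEmbedding.injective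
  have h2 : Small.{v} (Filter M) := small_of_injective (fun _ _ ↦ Filter.filter_eq)
  exact small_subset (subset_univ _)

variable (S h) in
/-- The space underlying the maximal extension: the set of all traces, with the topology of the
space of filters on `M`. -/
abbrev MaxSpace [Small.{v} (traces.{u, v} S h)] : Type v := Shrink.{v} (traces.{u, v} S h)

variable [Small.{v} (traces.{u, v} S h)]

/-- The filter on `M` which is a given point of the maximal extension. -/
noncomputable def MaxSpace.toFilter (z : MaxSpace.{u, v} S h) : Filter M :=
  (((Shrink.homeomorph _).symm z : traces.{u, v} S h) : Filter M)

theorem MaxSpace.isEmbedding_toFilter :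
    IsEmbedding (MaxSpace.toFilter : MaxSpace.{u, v} S h → Filter M) :=
  IsEmbedding.subtypeVal.comp (Homeomorph.isEmbedding _)

theorem MaxSpace.mem_nhds_iff {z : MaxSpace.{u, v} S h} {W : Set (MaxSpace.{u, v} S h)} :
    W ∈ 𝓝 z ↔ ∃ s ∈ z.toFilter, ∀ z' : MaxSpace.{u, v} S h, s ∈ z'.toFilter → z' ∈ W := by
  rw [isEmbedding_toFilter.isInducing.nhds_eq_comap, mem_comap]
  constructor
  · rintro ⟨V, hV, hVW⟩
    obtain ⟨s, hs, hsV⟩ := Filter.mem_nhds_iff.mp hV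
    exact ⟨s, hs, fun z' hz' ↦ hVW (hsV (le_principal_iff.mpr hz'))⟩
  · rintro ⟨s, hs, hsW⟩
    exact ⟨{F | s ∈ F}, isOpen_setOfPred_mem.mem_nhds hs, fun z' hz' ↦ hsW z' hz'⟩

namespace RegularExtension

/-- The map of an extension into the maximal extension. -/
noncomputable def toMax (A : RegularExtension.{u, v} S h) (p : A.N) : MaxSpace.{u, v} S h :=
  Shrink.homeomorph _ ⟨A.trace p, A, p, rfl⟩

variable (A B : RegularExtension.{u, v} S h)

theorem toFilter_toMax (p : A.N) : (A.toMax p).toFilter = A.trace p := by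
  simp [MaxSpace.toFilter, toMax]

theorem isEmbedding_toMax : IsEmbedding A.toMax := by
  refine IsEmbedding.of_comp ?_ MaxSpace.isEmbedding_toFilter.continuous ?_
  · refine MaxSpace.isEmbedding_toFilter.continuous_iff.mpr ?_
    exact A.isEmbedding_trace.continuous.congr fun p ↦ (A.toFilter_toMax p).symm
  · have h0 : MaxSpace.toFilter ∘ A.toMax = A.trace := funext A.toFilter_toMax
    exact h0 ▸ A.isEmbedding_trace

theorem exists_toMax_eq (z : MaxSpace.{u, v} S h) :
    ∃ (A : RegularExtension.{u, v} S h) (p : A.N), A.toMax p = z := by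
  obtain ⟨A, p, hp⟩ := ((Shrink.homeomorph _).symm z).2
  exact ⟨A, p, MaxSpace.isEmbedding_toFilter.injective ((A.toFilter_toMax p).trans hp)⟩

/-- By `exists_mem_trace_forall`, a basic neighbourhood of a trace of A contains only traces of A.
-/
theorem isOpenEmbedding_toMax (hS : ¬ S.HasIntertwinedGeodesics h) :
    IsOpenEmbedding A.toMax := by
  refine ⟨A.isEmbedding_toMax, isOpen_iff_mem_nhds.mpr ?_⟩
  rintro _ ⟨p, rfl⟩
  obtain ⟨s, hs, hsA⟩ := A.exists_mem_trace_forall hS p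
  refine MaxSpace.mem_nhds_iff.mpr ⟨s, by rwa [toFilter_toMax], fun z hz ↦ ?_⟩
  obtain ⟨B, q, rfl⟩ := exists_toMax_eq z
  rw [toFilter_toMax] at hz
  obtain ⟨p', hp'⟩ := hsA B q hz
  exact ⟨p', MaxSpace.isEmbedding_toFilter.injective (by simpa [toFilter_toMax] using hp')⟩

theorem toMax_ι (x : M) : A.toMax (A.ι x) = B.toMax (B.ι x) :=
  MaxSpace.isEmbedding_toFilter.injective (by simp [toFilter_toMax, trace_apply])

variable {A B}

theorem t2Space_maxSpace (hS : ¬ S.HasIntertwinedGeodesics h) :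
    T2Space (MaxSpace.{u, v} S h) := by
  refine t2Space_iff_disjoint_nhds.mpr fun z w hzw ↦ ?_
  obtain ⟨A, p, rfl⟩ := exists_toMax_eq z
  obtain ⟨B, q, rfl⟩ := exists_toMax_eq w
  have hne : A.trace p ≠ B.trace q := fun h0 ↦
    hzw (MaxSpace.isEmbedding_toFilter.injective (by simpa [toFilter_toMax] using h0))
  obtain ⟨s, hs, t, ht, hst⟩ := Filter.disjoint_iff.mp (disjoint_trace_of_ne hS hne)
  refine Filter.disjoint_iff.mpr ⟨{z | s ∈ z.toFilter}, ?_, {z | t ∈ z.toFilter}, ?_, ?_⟩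
  · exact MaxSpace.mem_nhds_iff.mpr ⟨s, by rwa [toFilter_toMax], fun _ h ↦ h⟩
  · exact MaxSpace.mem_nhds_iff.mpr ⟨t, by rwa [toFilter_toMax], fun _ h ↦ h⟩
  · refine Set.disjoint_left.mpr fun z hz hz' ↦ ?_
    obtain ⟨C, r, rfl⟩ := exists_toMax_eq z
    rw [mem_ofPred_eq, toFilter_toMax] at hz hz'
    have := inter_mem hz hz'
    rw [hst.inter_eq] at this
    exact (C.trace_neBot r).ne (empty_mem_iff_bot.mp this)

/-- The family of extensions may be uncountable, so a base is built from data on M: a countable base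
of M and the thickenings with centres in a countable dense set of timelike vectors and radii 1/n. -/
theorem secondCountableTopology_maxSpace [SecondCountableTopology M] :
    SecondCountableTopology (MaxSpace.{u, v} S h) := by
  have hTM : SecondCountableTopology (TangentBundle (𝓡 d) M) :=
    secondCountableTopology_tangentBundle
  let T : Set (TangentBundle (𝓡 d) M) := {X | S.IsTimelike X}
  obtain ⟨D, hDc, hD⟩ := TopologicalSpace.exists_countable_dense T
  let 𝒰 : Set (Set M) := TopologicalSpace.countableBasis M ∪
    image2 (fun (X : T) (n : ℕ) ↦ S.thickening h X.1 (1 / (n : ℝ))) D univ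
  have h𝒰c : 𝒰.Countable :=
    (TopologicalSpace.countable_countableBasis M).union (hDc.image2 countable_univ _)
  have h𝒰 : ∀ z : MaxSpace.{u, v} S h, ∀ s ∈ z.toFilter, ∃ U ∈ 𝒰, U ∈ z.toFilter ∧ U ⊆ s := by
    intro z s hs
    obtain ⟨A, p, rfl⟩ := exists_toMax_eq z
    rw [toFilter_toMax] at hs ⊢
    by_cases hp : p ∈ range A.ι
    · obtain ⟨x, rfl⟩ := hp
      rw [trace_apply] at hs ⊢
      obtain ⟨U, hU, hxU, hUs⟩ := (TopologicalSpace.isBasis_countableBasis M).mem_nhds_iff.mp hs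
      exact ⟨U, Or.inl hU, (TopologicalSpace.isOpen_of_mem_countableBasis hU).mem_nhds hxU, hUs⟩
    · obtain ⟨γ, hγ, hγp⟩ := A.exists_geodesic p (A.not_mem_range_iff.mp hp)
      rw [← tendsto_trace_iff] at hγp
      obtain ⟨⟨n, m⟩, ⟨hn, hm⟩, hsub⟩ := (trace_hasBasis hp hγ hγp).mem_iff.mp hs
      have hnI := one_sub_inv_mem_Ico hn
      set Y := velocity d γ (1 - 1 / (n : ℝ)) with hY
      have hYt : S.IsTimelike Y := (hγ.2 _ hnI).1
      have hm' : (0 : ℝ) < m := by exact_mod_cast hm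
      -- A centre X within 1/(2m) of Y works: the ball of radius 1/(2m) about X contains Y and lies
      -- in the ball of radius 1/m about Y.
      have hr : 0 < 1 / ((2 * m : ℕ) : ℝ) := by
        push_cast
        positivity
      have hnhds : (Subtype.val : T → _) ⁻¹' {X | h.dist Y X < 1 / ((2 * m : ℕ) : ℝ)} ∈
          𝓝 (⟨Y, hYt⟩ : T) :=
        continuous_subtype_val.continuousAt.preimage_mem_nhds ((h.nhds_basis Y).mem_of_mem hr)
      obtain ⟨X, hXY, hXD⟩ := mem_closure_iff_nhds.mp (hD ⟨Y, hYt⟩) _ hnhds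
      have hXY' : h.dist Y X < 1 / ((2 * m : ℕ) : ℝ) := hXY
      refine ⟨S.thickening h X.1 (1 / ((2 * m : ℕ) : ℝ)), Or.inr ⟨X, hXD, 2 * m, trivial, rfl⟩,
        thickening_mem_trace hp hγ hγp hnI X.2 hr ?_, Subset.trans ?_ hsub⟩
      · exact (h.dist_comm _ _).trans_lt hXY'
      · rintro x ⟨Z, hZ, hx⟩
        refine ⟨Z, ?_, hx⟩
        have h1 : h.dist X Z < 1 / ((2 * m : ℕ) : ℝ) := hZ
        have h2 : 1 / ((2 * m : ℕ) : ℝ) + 1 / ((2 * m : ℕ) : ℝ) = 1 / (m : ℝ) := by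
          push_cast
          field_simp
          norm_num
        exact (h.dist_triangle Y X Z).trans_lt (by linarith)
  refine (TopologicalSpace.isTopologicalBasis_of_isOpen_of_nhds
    (s := (fun U : Set M ↦ {z : MaxSpace.{u, v} S h | U ∈ z.toFilter}) '' 𝒰) ?_ ?_
    ).secondCountableTopology (h𝒰c.image _)
  · rintro _ ⟨U, -, rfl⟩
    exact isOpen_iff_mem_nhds.mpr fun z hz ↦ MaxSpace.mem_nhds_iff.mpr ⟨U, hz, fun _ h ↦ h⟩
  · intro z W hz hW
    obtain ⟨s, hs, hsW⟩ := MaxSpace.mem_nhds_iff.mp (hW.mem_nhds hz)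
    obtain ⟨U, hU, hUz, hUs⟩ := h𝒰 z s hs
    exact ⟨_, mem_image_of_mem _ hU, hUz, fun z' hz' ↦ hsW z' (mem_of_superset hz' hUs)⟩

variable (S h) in
/-- The charts of the maximal extension are the charts of all extensions. -/
noncomputable abbrev maxChartedSpace (hS : ¬ S.HasIntertwinedGeodesics h) :
    ChartedSpace (EuclideanHalfSpace d) (MaxSpace.{u, v} S h) where
  atlas := {e | ∃ (A : RegularExtension.{u, v} S h) (p : A.N),
    e = (chartAt (EuclideanHalfSpace d) p).lift_openEmbedding (A.isOpenEmbedding_toMax hS)}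
  chartAt z := (chartAt (EuclideanHalfSpace d)
    (exists_toMax_eq z).choose_spec.choose).lift_openEmbedding
      ((exists_toMax_eq z).choose.isOpenEmbedding_toMax hS)
  mem_chart_source z := by
    rw [OpenPartialHomeomorph.lift_openEmbedding_source]
    exact ⟨_, mem_chart_source _ _, (exists_toMax_eq z).choose_spec.choose_spec⟩
  chart_mem_atlas z := ⟨_, _, rfl⟩

/-- Interior points are defined through the preferred chart, here lifted from a chart of some
extension B at a preimage p, so the question reduces to `range_eq` for B. -/
theorem mem_interior_maxSpace_iff (hS : ¬ S.HasIntertwinedGeodesics h)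
    (A : RegularExtension.{u, v} S h) (z : MaxSpace.{u, v} S h) :
    letI := maxChartedSpace S h hS
    z ∈ (𝓡∂ d).interior (MaxSpace.{u, v} S h) ↔ z ∈ range (A.toMax ∘ A.ι) := by
  let := maxChartedSpace S h hS
  obtain ⟨B, p, rfl, hchart⟩ : ∃ (B : RegularExtension.{u, v} S h) (p : B.N), B.toMax p = z ∧
      chartAt (EuclideanHalfSpace d) z = (chartAt (EuclideanHalfSpace d) p).lift_openEmbedding
        (B.isOpenEmbedding_toMax hS) :=
    ⟨_, _, (exists_toMax_eq z).choose_spec.choose_spec, rfl⟩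
  have h1 : B.toMax p ∈ (𝓡∂ d).interior (MaxSpace.{u, v} S h) ↔ p ∈ (𝓡∂ d).interior B.N := by
    simp only [ModelWithCorners.interior, ModelWithCorners.IsInteriorPoint, mem_ofPred_eq,
      extChartAt, OpenPartialHomeomorph.extend_coe, Function.comp_apply]
    rw [hchart, OpenPartialHomeomorph.lift_openEmbedding_apply]
  rw [h1, ← B.range_eq]
  constructor
  · rintro ⟨x, rfl⟩
    exact ⟨x, A.toMax_ι B x⟩
  · rintro ⟨x, hx⟩
    exact ⟨x, (B.isEmbedding_toMax.injective (hx.symm.trans (A.toMax_ι B x))).symm⟩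

theorem tendsto_toMax_iff {α : Type*} {l : Filter α} {f : α → M} {p : B.N} :
    Tendsto (A.toMax ∘ A.ι ∘ f) l (𝓝 (B.toMax p)) ↔ Tendsto (B.ι ∘ f) l (𝓝 p) := by
  rw [B.isEmbedding_toMax.isInducing.tendsto_nhds_iff]
  have : A.toMax ∘ A.ι ∘ f = B.toMax ∘ B.ι ∘ f := funext fun t ↦ A.toMax_ι B (f t)
  rw [this]

/-- Embeddings over M preserve and reflect limits. Thus axioms on thickenings can be checked in each
extension separately. -/
theorem preimage_thickeningIn_max (X : TangentBundle (𝓡 d) M) (r : ℝ) :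
    B.toMax ⁻¹' (S.thickeningIn h (A.toMax ∘ A.ι) X r) = S.thickeningIn h B.ι X r := by
  ext p
  refine or_congr ?_ ?_
  · refine exists_congr fun x ↦ and_congr Iff.rfl ?_
    rw [Function.comp_apply, A.toMax_ι B]
    exact B.isEmbedding_toMax.injective.eq_iff
  · refine exists_congr fun Y ↦ and_congr Iff.rfl <| and_congr Iff.rfl <|
      exists_congr fun γ ↦ exists_congr fun a ↦ exists_congr fun b ↦ and_congr Iff.rfl ?_
    exact tendsto_toMax_iff

theorem isOpen_thickeningIn_max (hS : ¬ S.HasIntertwinedGeodesics h)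
    (A : RegularExtension.{u, v} S h) (X : TangentBundle (𝓡 d) M) (r : ℝ) (hX : S.IsTimelike X)
    (hr : 0 < r) : IsOpen (S.thickeningIn h (A.toMax ∘ A.ι) X r) := by
  refine isOpen_iff_mem_nhds.mpr fun z hz ↦ ?_
  obtain ⟨B, p, rfl⟩ := exists_toMax_eq z
  refine mem_of_superset (((B.isOpenEmbedding_toMax hS).isOpenMap _
    (B.isOpen_thickening X r hX hr)).mem_nhds ⟨p, ?_, rfl⟩) ?_
  · rwa [← preimage_thickeningIn_max (A := A)]
  · rw [← preimage_thickeningIn_max (A := A)]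
    exact image_preimage_subset _ _

theorem not_mem_range_of_mem_boundary (hS : ¬ S.HasIntertwinedGeodesics h) {p : B.N}
    (hp : letI := maxChartedSpace S h hS
      B.toMax p ∈ (𝓡∂ d).boundary (MaxSpace.{u, v} S h)) : p ∉ range B.ι := by
  let := maxChartedSpace S h hS
  rw [← ModelWithCorners.compl_interior, mem_compl_iff, mem_interior_maxSpace_iff hS B] at hp
  rintro ⟨x, rfl⟩
  exact hp ⟨x, rfl⟩

/-- A neighbourhood is given by a set s in the trace, which contains some basic O^M. Any point of
the corresponding thickening lies, within its own extension, in an open set with preimage O^M, so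
its trace contains s. -/
theorem nhds_hasBasis_max (hS : ¬ S.HasIntertwinedGeodesics h) (A : RegularExtension.{u, v} S h)
    {p : B.N} (hp : p ∉ range B.ι) {γ : ℝ → M} (hγ : S.IsFutureTimelikeGeodesic γ)
    (hγp : Tendsto (A.toMax ∘ A.ι ∘ γ) (𝓝[<] 1) (𝓝 (B.toMax p))) :
    (𝓝 (B.toMax p)).HasBasis (fun k : ℕ × ℕ ↦ 0 < k.1 ∧ 0 < k.2)
      (fun k ↦ S.thickeningIn h (A.toMax ∘ A.ι) (velocity d γ (1 - 1 / (k.1 : ℝ)))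
        (1 / (k.2 : ℝ))) := by
  rw [tendsto_toMax_iff] at hγp
  refine ⟨fun W ↦ ⟨fun hW ↦ ?_, ?_⟩⟩
  · obtain ⟨s, hs, hsW⟩ := MaxSpace.mem_nhds_iff.mp hW
    rw [toFilter_toMax] at hs
    obtain ⟨k, hk, hks⟩ :=
      (trace_hasBasis hp hγ (B.tendsto_trace_iff.mpr hγp)).mem_iff.mp hs
    refine ⟨k, hk, fun z hz ↦ hsW z ?_⟩
    obtain ⟨C, q, rfl⟩ := exists_toMax_eq z
    rw [← mem_preimage, preimage_thickeningIn_max] at hz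
    have hk2 : (0 : ℝ) < k.2 := by exact_mod_cast hk.2
    have hopen := C.isOpen_thickening _ (1 / (k.2 : ℝ)) (hγ.2 _ (one_sub_inv_mem_Ico hk.1)).1
      (by positivity)
    have h1 := preimage_mem_comap (m := C.ι) (hopen.mem_nhds hz)
    rw [preimage_thickeningIn] at h1
    rw [toFilter_toMax]
    exact mem_of_superset h1 hks
  · rintro ⟨k, hk, hkW⟩
    have hk2 : (0 : ℝ) < k.2 := by exact_mod_cast hk.2
    refine mem_of_superset ((isOpen_thickeningIn_max hS A _ _
      (hγ.2 _ (one_sub_inv_mem_Ico hk.1)).1 (by positivity)).mem_nhds ?_) hkW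
    rw [← mem_preimage, preimage_thickeningIn_max]
    exact mem_of_mem_nhds ((B.nhds_basis p (B.not_mem_range_iff.mp hp) γ hγ hγp).mem_of_mem hk)

/-- The maximal extension. -/
noncomputable def maximalExtension [SecondCountableTopology M]
    (hS : ¬ S.HasIntertwinedGeodesics h) (A : RegularExtension.{u, v} S h) :
    RegularExtension.{u, v} S h :=
  letI := maxChartedSpace S h hS
  { N := MaxSpace.{u, v} S h
    charts := maxChartedSpace S h hS
    t2 := t2Space_maxSpace hS
    secondCountable := secondCountableTopology_maxSpace
    ι := A.toMax ∘ A.ι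
    isEmbedding := A.isEmbedding_toMax.comp A.isEmbedding
    range_eq := by
      ext z
      exact (mem_interior_maxSpace_iff hS A z).symm
    exists_curve := fun z hz ↦ by
      obtain ⟨B, p, rfl⟩ := exists_toMax_eq z
      obtain ⟨γ, hγ, hγp⟩ := B.exists_curve p
        (B.not_mem_range_iff.mp (not_mem_range_of_mem_boundary hS hz))
      exact ⟨γ, hγ, tendsto_toMax_iff.mpr hγp⟩
    exists_geodesic := fun z hz ↦ by
      obtain ⟨B, p, rfl⟩ := exists_toMax_eq z
      obtain ⟨γ, hγ, hγp⟩ := B.exists_geodesic p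
        (B.not_mem_range_iff.mp (not_mem_range_of_mem_boundary hS hz))
      exact ⟨γ, hγ, tendsto_toMax_iff.mpr hγp⟩
    isOpen_thickening := isOpen_thickeningIn_max hS A
    nhds_basis := fun z hz γ hγ hγz ↦ by
      obtain ⟨B, p, rfl⟩ := exists_toMax_eq z
      exact nhds_hasBasis_max hS A (not_mem_range_of_mem_boundary hS hz) hγ hγz }

theorem isMaximal_maximalExtension [SecondCountableTopology M]
    (hS : ¬ S.HasIntertwinedGeodesics h) (A : RegularExtension.{u, v} S h) :
    (A.maximalExtension hS).IsMaximal := fun B ↦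
  ⟨B.toMax, B.isEmbedding_toMax, fun x ↦ B.toMax_ι A x⟩

end RegularExtension

end MaximalExtension

/-- Two extensions which embed in each other are equivalent. -/
theorem RegularExtension.EmbedsIn.equivalent {d : ℕ} [NeZero d] {M : Type u} [TopologicalSpace M]
    [ChartedSpace (EuclideanSpace ℝ (Fin d)) M] [IsManifold (𝓡 d) ∞ M]
    {S : Spacetime d M} {h : TangentDistance d M} {A B : RegularExtension.{u, v} S h}
    (hAB : A.EmbedsIn B) (hBA : B.EmbedsIn A) : A.Equivalent B := by
  obtain ⟨ψ, hψ, hψι⟩ := hAB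
  obtain ⟨φ, hφ, hφι⟩ := hBA
  -- Both composites fix the dense image of M, and the extensions are Hausdorff.
  have h1 : φ ∘ ψ = id := A.denseRange.equalizer (hφ.continuous.comp hψ.continuous) continuous_id
    (funext fun x ↦ by simp [hψι, hφι])
  have h2 : ψ ∘ φ = id := B.denseRange.equalizer (hψ.continuous.comp hφ.continuous) continuous_id
    (funext fun x ↦ by simp [hψι, hφι])
  exact ⟨{ toFun := ψ
           invFun := φ
           left_inv := congrFun h1
           right_inv := congrFun h2
           continuous_toFun := hψ.continuous
           continuous_invFun := hφ.continuous }, hψι⟩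

end GBoundary

theorem theorem4 {d : ℕ} [NeZero d] {M : Type u} [TopologicalSpace M] [T2Space M]
    [SecondCountableTopology M] [ConnectedSpace M]
    [ChartedSpace (EuclideanSpace ℝ (Fin d)) M] [IsManifold (𝓡 d) ∞ M]
    (S : GBoundary.Spacetime d M) (h : GBoundary.TangentDistance d M)
    (hcausal : S.StronglyCausal)
    (hextendible : Nonempty (GBoundary.RegularExtension.{u, v} S h))
    (hintertwined : ¬ S.HasIntertwinedGeodesics h) :
    ∃ A : GBoundary.RegularExtension.{u, v} S h, A.IsMaximal ∧
      ∀ B : GBoundary.RegularExtension.{u, v} S h, B.IsMaximal → A.Equivalent B := by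
  obtain ⟨A⟩ := hextendible
  have := A.small_traces
  have hmax := A.isMaximal_maximalExtension hintertwined
  exact ⟨_, hmax, fun B hB ↦ (hB _).equivalent (hmax B)⟩
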